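/- Let $\mathbb K=\mathbb R$ or $\mathbb C$. For an $n\times n$ real symmetric ($\mathbb K=\mathbb R$) or complex Hermitian ($\mathbb K=\mathbb C$) matrix $M$ write $\lambda_1(M)\ge\cdots\ge\lambda_n(M)$ for its eigenvalues counted with multiplicity. For every $n$ let $X_n$ be a random $n\times n$ matrix of this kind, all defined on one probability space. Assume that the empirical eigenvalue distribution $\frac1n\sum_{j=1}^n\delta_{\lambda_j(X_n)}$ converges weakly, almost surely, to a non-random compactly supported probability measure $\mu_X$ on $\mathbb R$. Let $a$ and $b$ be the infimum and the supremum of the support of $\mu_X$, and assume that $\lambda_n(X_n)\to a$ and $\lambda_1(X_n)\to b$ almost surely. Let $r\ge1$, let $0\le s\le r$, and let $\theta_1\ge\cdots\ge\theta_s>0>\theta_{s+1}\ge\cdots\ge\theta_r$ be deterministic real numbers that do not depend on $n$. For every $n\ge r$ let $P_n$ be a random $n\times n$ matrix of the same kind (symmetric or Hermitian), on the same probability space, of rank $r$, whose $r$ non-zero eigenvalues, counted with multiplicity, are $\theta_1,\dots,\theta_r$. Assume that for every $n\ge r$ the matrices $X_n$ and $P_n$ are independent and that the law of at least one of them is invariant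 under conjugation by all orthogonal (if $\mathbb K=\mathbb R$), respectively unitary (if $\mathbb K=\mathbb C$), $n\times n$ matrices. Put $\widetilde X_n=X_n+P_n$. Let $G_{\mu_X}(z)=\int\frac{1}{z-t}\,d\mu_X(t)$ for $z\notin\operatorname{supp}\mu_X$ be the Cauchy transform of $\mu_X$, let $G_{\mu_X}(b^+)=\lim_{z\downarrow b}G_{\mu_X}(z)\in(0,+\infty]$ and $G_{\mu_X}(a^-)=\lim_{z\uparrow a}G_{\mu_X}(z)\in[-\infty,0)$, with the convention $1/(\pm\infty)=0$, and let $G_{\mu_X}^{-1}$ denote the inverses of the decreasing homeomorphisms that $G_{\mu_X}$ induces from $(b,+\infty)$ onto $(0,G_{\mu_X}(b^+))$ and from $(-\infty,a)$ onto $(G_{\mu_X}(a^-),0)$. Then, as $n\to\infty$: (1) for each $1\le i\le s$, almost surely $$\lambda_i(\widetilde X_n)\longrightarrow\begin{cases}G_{\mu_X}^{-1}(1/\theta_i)&\text{if }\theta_i>1/G_{\mu_X}(b^+),\\ b&\text{otherwise;}\end{cases}$$ (2) for each fixed $i>s$, almost surely $\lambda_i(\widetilde X_n)\to b$; (3) for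 each $0\le j<r-s$, almost surely $$\lambda_{n-j}(\widetilde X_n)\longrightarrow\begin{cases}G_{\mu_X}^{-1}(1/\theta_{r-j})&\text{if }\theta_{r-j}<1/G_{\mu_X}(a^-),\\ a&\text{otherwise;}\end{cases}$$ (4) for each fixed $j\ge r-s$, almost surely $\lambda_{n-j}(\widetilde X_n)\to a$. -/

import Mathlib

open MeasureTheory ProbabilityTheory Filter Topology
open scoped NNReal ENNReal

noncomputable section

namespace SpikedModel

/-- Matrices carry the product (entrywise) sigma-algebra. -/
instance instMeasurableSpaceMatrix {m n α : Type*} [MeasurableSpace α] :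
    MeasurableSpace (Matrix m n α) :=
  inferInstanceAs (MeasurableSpace (m → n → α))

/-- `lam hA k` is the `k`-th largest eigenvalue of the `n × n` Hermitian matrix `A`, counted with
multiplicity, for `1 ≤ k ≤ n`; outside that range of indices it is `0`. -/
def lam {𝕜 : Type*} [RCLike 𝕜] {n : ℕ} {A : Matrix (Fin n) (Fin n) 𝕜} (hA : A.IsHermitian)
    (k : ℕ) : ℝ :=
  if h : 1 ≤ k ∧ k ≤ n then
    hA.eigenvalues₀ ⟨k - 1, by rw [Fintype.card_fin]; omega⟩
  else 0

/-- The empirical eigenvalue distribution `(1/n) ∑ₖ δ_{λₖ(A)}` (the zero measure if `n = 0`). -/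
def empiricalSpectralMeasure {𝕜 : Type*} [RCLike 𝕜] {n : ℕ} {A : Matrix (Fin n) (Fin n) 𝕜}
    (hA : A.IsHermitian) : FiniteMeasure ℝ :=
  (n : ℝ≥0)⁻¹ • ∑ k ∈ Finset.Icc 1 n, (diracProba (lam hA k)).toFiniteMeasure

/-- The law of the random matrix `M` is invariant under conjugation by every unitary matrix over
`𝕜` (for `𝕜 = ℝ`: by every orthogonal matrix). -/
def IsConjInvariant {Ω 𝕜 : Type*} [MeasurableSpace Ω] [RCLike 𝕜] {n : ℕ}
    (M : Ω → Matrix (Fin n) (Fin n) 𝕜) (Pr : Measure Ω) : Prop :=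
  ∀ U ∈ Matrix.unitaryGroup (Fin n) 𝕜, Pr.map (fun ω => U * M ω * star U) = Pr.map M

/-- The Cauchy transform `G_μ(z) = ∫ 1/(z - t) dμ(t)` at real points `z` off the support. -/
def cauchyTransform (μ : Measure ℝ) (z : ℝ) : ℝ := ∫ t, 1 / (z - t) ∂μ

/-- `G_μ(c⁺)`, the limit of `G_μ(z)` as `z ↓ c`, in the extended reals. -/
def cauchyRight (μ : Measure ℝ) (c : ℝ) : EReal :=
  Function.rightLim (fun z => (cauchyTransform μ z : EReal)) c

/-- `G_μ(c⁻)`, the limit of `G_μ(z)` as `z ↑ c`, in the extended reals. -/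
def cauchyLeft (μ : Measure ℝ) (c : ℝ) : EReal :=
  Function.leftLim (fun z => (cauchyTransform μ z : EReal)) c

/-- `G_μ⁻¹`: the inverse of `G_μ` restricted to the complement `(-∞, a) ∪ (b, ∞)` of the convex
hull `[a, b]` of the support of `μ`. There `G_μ` is injective, negative on the left component and
positive on the right one, with image `(G_μ(a⁻), 0) ∪ (0, G_μ(b⁺))`. -/
def cauchyInverse (μ : Measure ℝ) (y : ℝ) : ℝ :=
  Function.invFunOn (cauchyTransform μ) (convexHull ℝ μ.support)ᶜ y

end SpikedModel

end

open SpikedModel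

/-!
Let `G` be the Cauchy transform of `μ`. For `z` above the spectrum of `X`, a Schur complement turns
the number of eigenvalues of `X + U Θ Uᴴ` above `z` into a count of the eigenvalues of the `r × r`
matrix `Uᴴ (z - X)⁻¹ U` against `Θ⁻¹`. In generic position this compressed resolvent converges to
`G(z) • 1`, so the number of outliers above `z` is the number of spikes with `θ G(z) > 1`, and the
`i`-th outlier sits where `θᵢ G = 1`.

For the convergence, invariance allows `X` to be conjugated by an independent Haar unitary `V`. For
a traceless Hermitian `H` the Haar fourth moment of the quadratic form of `V H Vᴴ` at `u` depends
only on the norm of `u`, so it may be averaged over the sign vectors `u ∈ {±1}ⁿ`, which turns it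
into the fourth moment of a Rademacher chaos, at most a constant times the fourth power of the
Frobenius norm of `H`. With Borel–Cantelli, the compression of the traceless part of the resolvent
vanishes almost surely. The smallest eigenvalues are the negatives of the largest ones of `-X - P`.
-/

namespace SpikedModel

open Matrix
open scoped ComplexOrder

variable {𝕜 : Type*} [RCLike 𝕜]

section HermitianForm

variable {m ι : Type*} [Fintype m] [Fintype ι]

/-- The Hermitian form `w ↦ w* A w` of a square matrix, as a real number. -/
noncomputable def hform (A : Matrix m m 𝕜) (w : m → 𝕜) : ℝ :=
  RCLike.re (star w ⬝ᵥ A *ᵥ w)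

theorem hform_add (A B : Matrix m m 𝕜) (w : m → 𝕜) : hform (A + B) w = hform A w + hform B w := by
  simp [hform, add_mulVec]

theorem hform_neg (A : Matrix m m 𝕜) (w : m → 𝕜) : hform (-A) w = -hform A w := by
  simp [hform, neg_mulVec]

theorem hform_sub (A B : Matrix m m 𝕜) (w : m → 𝕜) : hform (A - B) w = hform A w - hform B w := by
  simp [sub_eq_add_neg, hform_add, hform_neg]

theorem hform_conjTranspose_mul_mul (B : Matrix m ι 𝕜) (A : Matrix m m 𝕜) (w : ι → 𝕜) :
    hform (Bᴴ * A * B) w = hform A (B *ᵥ w) := by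
  simp only [hform, star_mulVec, dotProduct_mulVec, vecMul_vecMul, Matrix.mul_assoc]

theorem hform_mul_diagonal_mul_conjTranspose [DecidableEq ι] (U : Matrix m ι 𝕜) (d : ι → ℝ)
    (w : m → 𝕜) :
    hform (U * diagonal (fun j => (d j : 𝕜)) * Uᴴ) w = ∑ j, d j * ‖(Uᴴ *ᵥ w) j‖ ^ 2 := by
  have h := hform_conjTranspose_mul_mul Uᴴ (diagonal fun j => (d j : 𝕜)) w
  rw [conjTranspose_conjTranspose] at h
  rw [h, hform, dotProduct, map_sum]
  refine Finset.sum_congr rfl fun j _ => ?_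
  rw [mulVec_diagonal, Pi.star_apply, mul_left_comm, RCLike.star_def, RCLike.conj_mul,
    RCLike.re_ofReal_mul]
  norm_cast

theorem hform_smul_one [DecidableEq m] (c : ℝ) (w : m → 𝕜) :
    hform ((c : 𝕜) • (1 : Matrix m m 𝕜)) w = c * ∑ i, ‖w i‖ ^ 2 := by
  have h := hform_mul_diagonal_mul_conjTranspose (1 : Matrix m m 𝕜) (fun _ => c) w
  rwa [Matrix.one_mul, conjTranspose_one, Matrix.mul_one, one_mulVec, ← Finset.mul_sum,
    ← smul_one_eq_diagonal] at h

theorem hform_nonneg {A : Matrix m m 𝕜} (hA : A.PosSemidef) (w : m → 𝕜) :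
    0 ≤ hform A w :=
  (RCLike.nonneg_iff.mp (hA.dotProduct_mulVec_nonneg w)).1

end HermitianForm

section Subspaces

variable {E F : Type*} [AddCommGroup E] [Module 𝕜 E] [FiniteDimensional 𝕜 E]
  [AddCommGroup F] [Module 𝕜 F] [FiniteDimensional 𝕜 F]

theorem finrank_le_finrank_inf_ker_add (V : Submodule 𝕜 E) (f : E →ₗ[𝕜] F) :
    Module.finrank 𝕜 V ≤ Module.finrank 𝕜 (V ⊓ LinearMap.ker f : Submodule 𝕜 E) +
      Module.finrank 𝕜 F := by
  have h := (f.domRestrict V).finrank_range_add_finrank_ker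
  have hrange := Submodule.finrank_le (LinearMap.range (f.domRestrict V))
  have hker : Module.finrank 𝕜 (LinearMap.ker (f.domRestrict V)) =
      Module.finrank 𝕜 (V ⊓ LinearMap.ker f : Submodule 𝕜 E) := by
    rw [LinearMap.ker_domRestrict, ← Submodule.finrank_map_subtype_eq]
    exact congrArg (fun U : Submodule 𝕜 E => Module.finrank 𝕜 U) (Submodule.map_comap_subtype _ _)
  omega

theorem exists_ne_zero_mem_inf (V W : Submodule 𝕜 E)
    (h : Module.finrank 𝕜 E < Module.finrank 𝕜 V + Module.finrank 𝕜 W) :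
    ∃ w ∈ V, w ∈ W ∧ w ≠ 0 := by
  have hsum := Submodule.finrank_sup_add_finrank_inf_eq V W
  have hsup := Submodule.finrank_le (V ⊔ W)
  have hinf : V ⊓ W ≠ ⊥ := fun h0 => by rw [h0, finrank_bot] at hsum; omega
  obtain ⟨w, hw, hw0⟩ := Submodule.exists_mem_ne_zero_of_ne_bot hinf
  exact ⟨w, hw.1, hw.2, hw0⟩

theorem exists_submodule_forall_apply_eq_zero {m : Type*} [Fintype m] (B : E →ₗ[𝕜] m → 𝕜)
    (p : m → Prop) [DecidablePred p] :
    ∃ V : Submodule 𝕜 E, Module.finrank 𝕜 E ≤ Module.finrank 𝕜 V + Fintype.card {i // p i} ∧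
      ∀ w ∈ V, ∀ i, p i → B w i = 0 := by
  have h := finrank_le_finrank_inf_ker_add ⊤ (LinearMap.funLeft 𝕜 𝕜 (Subtype.val (p := p)) ∘ₗ B)
  rw [top_inf_eq, finrank_top, Module.finrank_fintype_fun_eq_card] at h
  exact ⟨_, h, fun w hw i hi => congrFun (LinearMap.mem_ker.mp hw) ⟨i, hi⟩⟩

end Subspaces

section Eigenvalues

variable {n : ℕ} {A : Matrix (Fin n) (Fin n) 𝕜}

theorem lam_apply (hA : A.IsHermitian) (i : Fin n) :
    lam hA (i + 1) = hA.eigenvalues₀ (Fin.cast (Fintype.card_fin n).symm i) := by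
  rw [lam, dif_pos ⟨by omega, i.2⟩]
  rfl

theorem lam_congr {B : Matrix (Fin n) (Fin n) 𝕜} (hA : A.IsHermitian) (hB : B.IsHermitian)
    (h : A = B) (k : ℕ) : lam hA k = lam hB k := by
  subst h
  rfl

theorem lam_antitone (hA : A.IsHermitian) {k l : ℕ} (hk : 1 ≤ k) (hkl : k ≤ l) (hl : l ≤ n) :
    lam hA l ≤ lam hA k := by
  rw [lam, dif_pos ⟨hk.trans hkl, hl⟩, lam, dif_pos ⟨hk, hkl.trans hl⟩]
  exact hA.eigenvalues₀_antitone (by simp only [Fin.mk_le_mk]; omega)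

theorem sum_lam (hA : A.IsHermitian) (f : ℝ → ℝ) :
    ∑ k ∈ Finset.Icc 1 n, f (lam hA k) = ∑ i : Fin n, f (lam hA (i + 1)) := by
  rw [Fin.sum_univ_eq_sum_range (fun i => f (lam hA (i + 1))), Finset.range_eq_Ico,
    Finset.sum_Ico_add' (fun i => f (lam hA i)) 0 n 1]
  rfl

theorem exists_sorted_eigenbasis (hA : A.IsHermitian) :
    ∃ e : OrthonormalBasis (Fin n) 𝕜 (EuclideanSpace 𝕜 (Fin n)),
      ∀ i, A.toEuclideanLin (e i) = (lam hA (i + 1) : 𝕜) • e i := by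
  refine ⟨((isSymmetric_toEuclideanLin_iff.mpr hA).eigenvectorBasis
    finrank_euclideanSpace).reindex (finCongr (Fintype.card_fin n)), fun i => ?_⟩
  rw [OrthonormalBasis.reindex_apply, LinearMap.IsSymmetric.apply_eigenvectorBasis, lam_apply]
  rfl

theorem exists_unitary_diagonalization (hA : A.IsHermitian) :
    ∃ W : unitaryGroup (Fin n) 𝕜,
      A = W.1 * diagonal (fun i : Fin n => (lam hA (i + 1) : 𝕜)) * W.1ᴴ := by
  obtain ⟨e, he⟩ := exists_sorted_eigenbasis hA
  let W : unitaryGroup (Fin n) 𝕜 := ⟨(EuclideanSpace.basisFun (Fin n) 𝕜).toBasis.toMatrix e.toBasis,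
    (EuclideanSpace.basisFun (Fin n) 𝕜).toMatrix_orthonormalBasis_mem_unitary e⟩
  have hW (k i) : W.1 k i = e i k := by simp [W, Module.Basis.toMatrix_apply]
  have hAW : A * W.1 = W.1 * diagonal (fun i : Fin n => (lam hA (i + 1) : 𝕜)) := by
    ext k i
    have h := congrArg (fun v : EuclideanSpace 𝕜 (Fin n) => v k) (he i)
    simp only [Matrix.toLpLin_apply, PiLp.smul_apply, smul_eq_mul] at h
    rw [mul_diagonal, hW, mul_comm, ← h, Matrix.mul_apply]
    simp only [hW]
    rfl
  refine ⟨W, ?_⟩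
  rw [← hAW, Matrix.mul_assoc, ← star_eq_conjTranspose, W.2.2, Matrix.mul_one]

theorem smul_one_eq_conj (W : unitaryGroup (Fin n) 𝕜) (c : 𝕜) :
    c • (1 : Matrix (Fin n) (Fin n) 𝕜) = W.1 * (c • 1) * W.1ᴴ := by
  rw [Matrix.mul_smul, Matrix.mul_one, Matrix.smul_mul,
    ← star_eq_conjTranspose, W.2.2]

theorem smul_one_sub_eq_conj_diagonal {W : unitaryGroup (Fin n) 𝕜} {d : Fin n → ℝ}
    (hW : A = W.1 * diagonal (fun i => (d i : 𝕜)) * W.1ᴴ) (z : ℝ) :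
    (z : 𝕜) • 1 - A = W.1 * diagonal (fun i => ((z - d i : ℝ) : 𝕜)) * W.1ᴴ := by
  rw [smul_one_eq_conj W, hW, ← Matrix.sub_mul, ← Matrix.mul_sub, smul_one_eq_diagonal,
    diagonal_sub]
  simp only [RCLike.ofReal_sub]

theorem hform_sub_smul_one_of_eq_conj_diagonal {W : unitaryGroup (Fin n) 𝕜} {d : Fin n → ℝ}
    (hW : A = W.1 * diagonal (fun i => (d i : 𝕜)) * W.1ᴴ) (z : ℝ) (w : Fin n → 𝕜) :
    hform (A - (z : 𝕜) • 1) w = ∑ i, (d i - z) * ‖(W.1ᴴ *ᵥ w) i‖ ^ 2 := by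
  rw [← neg_sub, hform_neg, smul_one_sub_eq_conj_diagonal hW,
    hform_mul_diagonal_mul_conjTranspose, ← Finset.sum_neg_distrib]
  simp only [← neg_mul, neg_sub]

theorem exists_submodule_hform_sub_lam_nonneg (hA : A.IsHermitian) {k : ℕ} (hkn : k ≤ n) :
    ∃ V : Submodule 𝕜 (Fin n → 𝕜), k ≤ Module.finrank 𝕜 V ∧
      ∀ w ∈ V, 0 ≤ hform (A - (lam hA k : 𝕜) • 1) w := by
  obtain ⟨W, hW⟩ := exists_unitary_diagonalization hA
  obtain ⟨V, hV, hV0⟩ := exists_submodule_forall_apply_eq_zero W.1ᴴ.mulVecLin (fun i => k ≤ i.1)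
  refine ⟨V, ?_, fun w hw => ?_⟩
  · have hcard : Fintype.card {i : Fin n // k ≤ i.1} = n - k := by
      have h := Fintype.card_subtype_compl fun i : Fin n => i.1 < k
      simpa [Fintype.card_subtype, Fin.card_filter_val_lt, hkn] using h
    rw [Module.finrank_fin_fun, hcard] at hV
    omega
  · rw [hform_sub_smul_one_of_eq_conj_diagonal hW]
    refine Finset.sum_nonneg fun i _ => ?_
    rcases le_or_gt k i.1 with hi | hi
    · simp [show (W.1ᴴ *ᵥ w) i = 0 from hV0 w hw i hi]
    · exact mul_nonneg (sub_nonneg.mpr (lam_antitone hA (by omega) hi hkn)) (by positivity)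

theorem exists_submodule_hform_sub_lam_nonpos (hA : A.IsHermitian) {k : ℕ} (hk : 1 ≤ k) :
    ∃ V : Submodule 𝕜 (Fin n → 𝕜), n < Module.finrank 𝕜 V + k ∧
      ∀ w ∈ V, hform (A - (lam hA k : 𝕜) • 1) w ≤ 0 := by
  obtain ⟨W, hW⟩ := exists_unitary_diagonalization hA
  obtain ⟨V, hV, hV0⟩ :=
    exists_submodule_forall_apply_eq_zero W.1ᴴ.mulVecLin (fun i => i.1 < k - 1)
  refine ⟨V, ?_, fun w hw => ?_⟩
  · have hcard : Fintype.card {i : Fin n // i.1 < k - 1} ≤ k - 1 := by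
      simp [Fintype.card_subtype, Fin.card_filter_val_lt]
    rw [Module.finrank_fin_fun] at hV
    omega
  · rw [hform_sub_smul_one_of_eq_conj_diagonal hW]
    refine Finset.sum_nonpos fun i _ => ?_
    rcases lt_or_ge i.1 (k - 1) with hi | hi
    · simp [show (W.1ᴴ *ᵥ w) i = 0 from hV0 w hw i hi]
    · exact mul_nonpos_of_nonpos_of_nonneg
        (sub_nonpos.mpr (lam_antitone hA hk (by omega) i.2)) (by positivity)

theorem le_of_hform_sub_smul_one {w : Fin n → 𝕜} (hw : w ≠ 0) {y z : ℝ}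
    (hy : 0 ≤ hform (A - (y : 𝕜) • 1) w) (hz : hform (A - (z : 𝕜) • 1) w ≤ 0) : y ≤ z := by
  rw [hform_sub, hform_smul_one] at hy hz
  have hpos : 0 < ∑ i, ‖w i‖ ^ 2 := by
    obtain ⟨i, hi⟩ := Function.ne_iff.mp hw
    exact Finset.sum_pos' (fun j _ => by positivity)
      ⟨i, Finset.mem_univ i, pow_pos (norm_pos_iff.mpr hi) 2⟩
  exact le_of_mul_le_mul_right (by linarith) hpos

theorem le_lam_of_forall_mem (hA : A.IsHermitian) {k : ℕ} (hk : 1 ≤ k) {z : ℝ}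
    {V : Submodule 𝕜 (Fin n → 𝕜)} (hV : k ≤ Module.finrank 𝕜 V)
    (h : ∀ w ∈ V, 0 ≤ hform (A - (z : 𝕜) • 1) w) : z ≤ lam hA k := by
  obtain ⟨V', hV', h'⟩ := exists_submodule_hform_sub_lam_nonpos hA hk
  obtain ⟨w, hw, hw', hw0⟩ := exists_ne_zero_mem_inf V V' (by rw [Module.finrank_fin_fun]; omega)
  exact le_of_hform_sub_smul_one hw0 (h w hw) (h' w hw')

theorem lam_le_of_forall_mem (hA : A.IsHermitian) {k : ℕ} (hkn : k ≤ n) {z : ℝ}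
    {V : Submodule 𝕜 (Fin n → 𝕜)} (hV : n < Module.finrank 𝕜 V + k)
    (h : ∀ w ∈ V, hform (A - (z : 𝕜) • 1) w ≤ 0) : lam hA k ≤ z := by
  obtain ⟨V', hV', h'⟩ := exists_submodule_hform_sub_lam_nonneg hA hkn
  obtain ⟨w, hw, hw', hw0⟩ := exists_ne_zero_mem_inf V V' (by rw [Module.finrank_fin_fun]; omega)
  exact le_of_hform_sub_smul_one hw0 (h' w hw') (h w hw)

theorem hform_neg_sub_smul_one (A : Matrix (Fin n) (Fin n) 𝕜) (z : ℝ) (w : Fin n → 𝕜) :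
    hform (-A - ((-z : ℝ) : 𝕜) • 1) w = -hform (A - (z : 𝕜) • 1) w := by
  rw [← hform_neg, RCLike.ofReal_neg, neg_smul, neg_sub, sub_neg_eq_add, neg_add_eq_sub]

theorem lam_neg (hA : A.IsHermitian) {k : ℕ} (hk : 1 ≤ k) (hkn : k ≤ n) :
    lam hA.neg k = -lam hA (n + 1 - k) := by
  obtain ⟨V, hV, h⟩ := exists_submodule_hform_sub_lam_nonneg hA (k := n + 1 - k) (by omega)
  obtain ⟨V', hV', h'⟩ := exists_submodule_hform_sub_lam_nonpos hA (k := n + 1 - k) (by omega)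
  refine le_antisymm (lam_le_of_forall_mem hA.neg hkn (V := V) (by omega) fun w hw => ?_)
    (le_lam_of_forall_mem hA.neg hk (V := V') (by omega) fun w hw => ?_)
  · rw [hform_neg_sub_smul_one]
    exact neg_nonpos.mpr (h w hw)
  · rw [hform_neg_sub_smul_one]
    exact neg_nonneg.mpr (h' w hw)

theorem posDef_smul_one_sub (hA : A.IsHermitian) {z : ℝ} (hz : lam hA 1 < z) :
    ((z : 𝕜) • 1 - A).PosDef := by
  obtain ⟨W, hW⟩ := exists_unitary_diagonalization hA
  rw [smul_one_sub_eq_conj_diagonal hW, ← star_eq_conjTranspose,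
    (Unitary.isUnit_coe (U := W)).posDef_star_right_conjugate_iff, posDef_diagonal_iff]
  exact fun i => RCLike.ofReal_pos.mpr
    (sub_pos.mpr ((lam_antitone hA le_rfl (by omega) i.2).trans_lt hz))

theorem lam_le_lam_one (hA : A.IsHermitian) (i : Fin n) : lam hA (i + 1) ≤ lam hA 1 :=
  lam_antitone hA le_rfl (by omega) i.2

end Eigenvalues

section Perturbation

variable {ι : Type*} [Fintype ι] [DecidableEq ι] {n : ℕ}

/-- `HasSpikes P θ U` says that `P = U diag(θ) U*` where `U` has orthonormal columns: the columns
of `U` are eigenvectors of `P` for the eigenvalues `θ`, and `P` vanishes on their orthogonal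
complement. -/
structure HasSpikes (P : Matrix (Fin n) (Fin n) 𝕜) (θ : ι → ℝ) (U : Matrix (Fin n) ι 𝕜) :
    Prop where
  conjTranspose_mul_self : Uᴴ * U = 1
  eq_conj_diagonal : P = U * diagonal (fun j => (θ j : 𝕜)) * Uᴴ

/-- The resolvent `(z - X)⁻¹`. -/
noncomputable def matrixResolvent (z : ℝ) (X : Matrix (Fin n) (Fin n) 𝕜) :
    Matrix (Fin n) (Fin n) 𝕜 :=
  ((z : 𝕜) • 1 - X)⁻¹

/-- The compression `U* (z - X)⁻¹ U` of the resolvent to the span of the columns of `U`. -/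
noncomputable def compressedResolvent (z : ℝ) (X : Matrix (Fin n) (Fin n) 𝕜)
    (U : Matrix (Fin n) ι 𝕜) : Matrix ι ι 𝕜 :=
  Uᴴ * matrixResolvent z X * U

variable {X P : Matrix (Fin n) (Fin n) 𝕜} {θ : ι → ℝ} {U : Matrix (Fin n) ι 𝕜} {z : ℝ}

theorem matrixResolvent_isHermitian (hX : X.IsHermitian) (z : ℝ) :
    (matrixResolvent z X).IsHermitian := by
  refine IsHermitian.inv (IsHermitian.sub ?_ hX)
  simp [IsHermitian, conjTranspose_smul]

omit [Fintype ι] [DecidableEq ι] in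
theorem compressedResolvent_isHermitian (hX : X.IsHermitian) (z : ℝ) (U : Matrix (Fin n) ι 𝕜) :
    (compressedResolvent z X U).IsHermitian :=
  isHermitian_conjTranspose_mul_mul _ (matrixResolvent_isHermitian hX z)

theorem HasSpikes.neg (hU : HasSpikes P θ U) : HasSpikes (-P) (-θ) U where
  conjTranspose_mul_self := hU.conjTranspose_mul_self
  eq_conj_diagonal := by
    rw [hU.eq_conj_diagonal, ← Matrix.neg_mul, ← Matrix.mul_neg, diagonal_neg]
    simp only [Pi.neg_apply, RCLike.ofReal_neg]

theorem HasSpikes.hform_eq (hU : HasSpikes P θ U) (w : Fin n → 𝕜) :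
    hform P w = ∑ j, θ j * ‖(Uᴴ *ᵥ w) j‖ ^ 2 := by
  rw [hU.eq_conj_diagonal, hform_mul_diagonal_mul_conjTranspose]

theorem lam_add_card_le_lam_add (hX : X.IsHermitian) (hP : P.IsHermitian) (hU : HasSpikes P θ U)
    {k : ℕ} (hk : 1 ≤ k) (hkn : k + Fintype.card ι ≤ n) :
    lam hX (k + Fintype.card ι) ≤ lam (hX.add hP) k := by
  obtain ⟨V, hV, h⟩ := exists_submodule_hform_sub_lam_nonneg hX hkn
  have hV' := finrank_le_finrank_inf_ker_add V Uᴴ.mulVecLin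
  rw [Module.finrank_fintype_fun_eq_card] at hV'
  refine le_lam_of_forall_mem _ hk (V := V ⊓ LinearMap.ker Uᴴ.mulVecLin) (by omega) ?_
  rintro w ⟨hwV, hwU⟩
  have hPw : hform P w = 0 := by
    have hw : Uᴴ *ᵥ w = 0 := LinearMap.mem_ker.mp hwU
    simp [hU.hform_eq, hw]
  rw [add_sub_right_comm, hform_add, hPw, add_zero]
  exact h w hwV

theorem HasSpikes.conj_add_sub_smul_one (hX : X.IsHermitian) (hz : ((z : 𝕜) • 1 - X).PosDef)
    (hU : HasSpikes P θ U) :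
    (matrixResolvent z X * U)ᴴ * (X + P - (z : 𝕜) • 1) * (matrixResolvent z X * U) =
      compressedResolvent z X U * diagonal (fun j => (θ j : 𝕜)) * compressedResolvent z X U -
        compressedResolvent z X U := by
  have hR : ((z : 𝕜) • 1 - X) * matrixResolvent z X = 1 :=
    mul_nonsing_inv _ ((isUnit_iff_isUnit_det _).mp hz.isUnit)
  have hmid : (X + P - (z : 𝕜) • 1) * (matrixResolvent z X * U) =
      P * matrixResolvent z X * U - U := by
    rw [← Matrix.mul_assoc, show X + P - (z : 𝕜) • 1 = P - ((z : 𝕜) • 1 - X) by abel,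
      Matrix.sub_mul, hR, Matrix.sub_mul, Matrix.one_mul]
  rw [Matrix.mul_assoc, hmid, conjTranspose_mul, (matrixResolvent_isHermitian hX z).eq,
    Matrix.mul_sub, hU.eq_conj_diagonal]
  simp only [compressedResolvent, Matrix.mul_assoc]

theorem le_lam_add (hX : X.IsHermitian) (hP : P.IsHermitian) (hz : ((z : 𝕜) • 1 - X).PosDef)
    (hU : HasSpikes P θ U) {J : Finset ι} {k : ℕ} (hk : 1 ≤ k) (hkJ : k ≤ J.card)
    (hJ : ((compressedResolvent z X U * diagonal (fun j => (θ j : 𝕜)) * compressedResolvent z X U -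
      compressedResolvent z X U).submatrix ((↑) : J → ι) (↑)).PosSemidef) :
    z ≤ lam (hX.add hP) k := by
  let E : Matrix ι J 𝕜 := (1 : Matrix ι ι 𝕜).submatrix id (↑)
  have hE (N : Matrix ι ι 𝕜) : Eᴴ * N * E = N.submatrix (↑) (↑) := by
    ext i j
    simp [E, Matrix.mul_apply, Matrix.one_apply]
  have hinj : Function.Injective (matrixResolvent z X * U * E).mulVecLin := by
    have hleft : Eᴴ * Uᴴ * ((z : 𝕜) • 1 - X) * (matrixResolvent z X * U * E) = 1 := by
      calc _ = Eᴴ * (Uᴴ * (((z : 𝕜) • 1 - X) * matrixResolvent z X) * U) * E := by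
            simp only [Matrix.mul_assoc]
        _ = 1 := by
          rw [matrixResolvent, mul_nonsing_inv _ ((isUnit_iff_isUnit_det _).mp hz.isUnit),
            Matrix.mul_one, hU.conjTranspose_mul_self, hE,
            submatrix_one _ Subtype.val_injective]
    refine Function.LeftInverse.injective
      (g := (Eᴴ * Uᴴ * ((z : 𝕜) • 1 - X)).mulVecLin) fun v => ?_
    rw [mulVecLin_apply, mulVecLin_apply, mulVec_mulVec, hleft, one_mulVec]
  refine le_lam_of_forall_mem _ hk
    (V := LinearMap.range (matrixResolvent z X * U * E).mulVecLin) ?_ ?_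
  · rwa [LinearMap.finrank_range_of_inj hinj, Module.finrank_fintype_fun_eq_card, Fintype.card_coe]
  · rintro _ ⟨v, rfl⟩
    rw [mulVecLin_apply, ← mulVec_mulVec, ← hform_conjTranspose_mul_mul,
      hU.conj_add_sub_smul_one hX hz, ← hform_conjTranspose_mul_mul, hE]
    exact hform_nonneg hJ v

-- Both conditions say that the block matrix `[[M, U], [Uᴴ, Θ⁻¹]]` is positive semidefinite.
theorem posSemidef_sub_conj_diagonal {M : Matrix (Fin n) (Fin n) 𝕜} (hM : M.PosDef)
    (hθ : ∀ j, 0 < θ j)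
    (h : (diagonal (fun j => (θ j : 𝕜)⁻¹) - Uᴴ * M⁻¹ * U).PosSemidef) :
    (M - U * diagonal (fun j => (θ j : 𝕜)) * Uᴴ).PosSemidef := by
  have hinv : (diagonal (fun j => (θ j : 𝕜)⁻¹))⁻¹ = diagonal (fun j => (θ j : 𝕜)) := by
    refine inv_eq_right_inv ?_
    rw [diagonal_mul_diagonal, ← diagonal_one]
    congr with j
    exact inv_mul_cancel₀ (RCLike.ofReal_ne_zero.mpr (hθ j).ne')
  have hD : (diagonal (fun j => (θ j : 𝕜)⁻¹)).PosDef := by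
    rw [posDef_diagonal_iff]
    exact fun j => RCLike.inv_pos_of_pos (RCLike.ofReal_pos.mpr (hθ j))
  let := hM.isUnit.invertible
  let := hD.isUnit.invertible
  rwa [← PosDef.fromBlocks₁₁ U _ hM, PosDef.fromBlocks₂₂ M U hD, hinv] at h

theorem lam_add_le (hX : X.IsHermitian) (hP : P.IsHermitian) (hz : ((z : 𝕜) • 1 - X).PosDef)
    (hU : HasSpikes P θ U) {J : Finset ι} (hθ : ∀ j ∈ J, 0 < θ j) {k : ℕ} (hkn : k ≤ n)
    (hkJ : Fintype.card {j // 0 < θ j ∧ j ∉ J} < k)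
    (hJ : ((diagonal (fun j => (θ j : 𝕜)⁻¹) - compressedResolvent z X U).submatrix
      ((↑) : J → ι) (↑)).PosSemidef) :
    lam (hX.add hP) k ≤ z := by
  obtain ⟨V, hV, hV0⟩ :=
    exists_submodule_forall_apply_eq_zero Uᴴ.mulVecLin (fun j => 0 < θ j ∧ j ∉ J)
  rw [Module.finrank_fin_fun] at hV
  refine lam_le_of_forall_mem _ hkn (V := V) (by omega) fun w hw => ?_
  let UJ : Matrix (Fin n) J 𝕜 := U.submatrix id (↑)
  have hform_P : hform P w ≤ hform (UJ * diagonal (fun j : J => (θ j : 𝕜)) * UJᴴ) w := by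
    rw [hU.hform_eq, hform_mul_diagonal_mul_conjTranspose UJ fun j : J => θ j]
    change _ ≤ ∑ j : J, θ j * ‖(Uᴴ *ᵥ w) j‖ ^ 2
    rw [Finset.sum_coe_sort J fun j => θ j * ‖(Uᴴ *ᵥ w) j‖ ^ 2,
      ← Finset.sum_add_sum_compl J, add_le_iff_nonpos_right]
    refine Finset.sum_nonpos fun j hj => ?_
    rcases le_or_gt (θ j) 0 with h0 | h0
    · exact mul_nonpos_of_nonpos_of_nonneg h0 (by positivity)
    · simp [show (Uᴴ *ᵥ w) j = 0 from hV0 w hw j ⟨h0, Finset.mem_compl.mp hj⟩]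
  have hJ' : (diagonal (fun j : J => (θ j : 𝕜)⁻¹) - UJᴴ * ((z : 𝕜) • 1 - X)⁻¹ * UJ).PosSemidef := by
    rwa [submatrix_sub, Pi.sub_apply, Pi.sub_apply,
      submatrix_diagonal _ _ Subtype.val_injective] at hJ
  have hSchur := hform_nonneg (posSemidef_sub_conj_diagonal hz (fun j : J => hθ j j.2) hJ') w
  rw [hform_sub] at hSchur
  rw [show X + P - (z : 𝕜) • 1 = P - ((z : 𝕜) • 1 - X) by abel, hform_sub]
  linarith

end Perturbation

section Asymptotics

theorem posSemidef_of_hform_nonneg {m : Type*} [Fintype m] {A : Matrix m m 𝕜} (hA : A.IsHermitian)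
    (h : ∀ w, 0 ≤ hform A w) : A.PosSemidef :=
  .of_dotProduct_mulVec_nonneg hA fun w =>
    RCLike.nonneg_iff.mpr ⟨h w, hA.im_star_dotProduct_mulVec_self w⟩

theorem abs_hform_le {m : Type*} [Fintype m] (A : Matrix m m 𝕜) (w : m → 𝕜) :
    |hform A w| ≤ (∑ i, ∑ j, ‖A i j‖) * ∑ i, ‖w i‖ ^ 2 := by
  have hprod (i j : m) : ‖w i‖ * ‖w j‖ ≤ ∑ l, ‖w l‖ ^ 2 := by
    have hi := Finset.single_le_sum (fun l _ => sq_nonneg ‖w l‖) (Finset.mem_univ i)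
    have hj := Finset.single_le_sum (fun l _ => sq_nonneg ‖w l‖) (Finset.mem_univ j)
    nlinarith [sq_nonneg (‖w i‖ - ‖w j‖)]
  calc |hform A w| ≤ ‖∑ i, star (w i) * ∑ j, A i j * w j‖ := RCLike.abs_re_le_norm _
    _ ≤ ∑ i, ∑ j, ‖A i j‖ * (‖w i‖ * ‖w j‖) := by
        refine (norm_sum_le _ _).trans (Finset.sum_le_sum fun i _ => ?_)
        rw [Finset.mul_sum]
        refine (norm_sum_le _ _).trans_eq (Finset.sum_congr rfl fun j _ => ?_)
        rw [norm_mul, norm_mul, norm_star, mul_left_comm]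
    _ ≤ ∑ i, ∑ j, ‖A i j‖ * ∑ l, ‖w l‖ ^ 2 := by gcongr; exact hprod _ _
    _ = _ := by simp only [Finset.sum_mul]

theorem eventually_posSemidef {α m : Type*} [Finite m] [DecidableEq m] {l : Filter α}
    {M : α → Matrix m m 𝕜} {d : m → ℝ} (hd : ∀ i, 0 < d i) (hM : ∀ a, (M a).IsHermitian)
    (h : Tendsto M l (𝓝 (diagonal fun i => (d i : 𝕜)))) : ∀ᶠ a in l, (M a).PosSemidef := by
  have := Fintype.ofFinite m
  obtain ⟨c, hc, hcd⟩ : ∃ c > 0, ∀ i, c ≤ d i := by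
    rcases isEmpty_or_nonempty m with hm | hm
    · exact ⟨1, one_pos, fun i => hm.elim i⟩
    · obtain ⟨i, hi⟩ := Finite.exists_min d
      exact ⟨d i, hd i, hi⟩
  have herr : Tendsto (fun a => ∑ i, ∑ j, ‖(M a - diagonal fun i => (d i : 𝕜)) i j‖) l (𝓝 0) := by
    have h0 : Tendsto (fun a => M a - diagonal fun i => (d i : 𝕜)) l (𝓝 0) :=
      tendsto_sub_nhds_zero_iff.mpr h
    have hcont : Continuous fun N : Matrix m m 𝕜 => ∑ i, ∑ j, ‖N i j‖ := by fun_prop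
    simpa [Function.comp_def] using (hcont.tendsto 0).comp h0
  filter_upwards [herr.eventually (gt_mem_nhds hc)] with a ha
  refine posSemidef_of_hform_nonneg (hM a) fun w => ?_
  have hdiag : c * ∑ i, ‖w i‖ ^ 2 ≤ hform (diagonal fun i => (d i : 𝕜)) w := by
    have hsum := hform_mul_diagonal_mul_conjTranspose (1 : Matrix m m 𝕜) d w
    rw [Matrix.one_mul, conjTranspose_one, Matrix.mul_one, one_mulVec] at hsum
    rw [hsum, Finset.mul_sum]
    gcongr with i
    exact hcd i
  have habs := (abs_le.mp (abs_hform_le (M a - diagonal fun i => (d i : 𝕜)) w)).1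
  rw [hform_sub] at habs
  have hS : 0 ≤ ∑ i, ‖w i‖ ^ 2 := by positivity
  nlinarith [mul_le_mul_of_nonneg_right ha.le hS]

variable {ι : Type*} [Fintype ι] [DecidableEq ι] {X P : ∀ n, Matrix (Fin n) (Fin n) 𝕜}
  {θ : ι → ℝ} {U : ∀ n, Matrix (Fin n) ι 𝕜} {z g : ℝ}

theorem eventually_le_lam_add (hX : ∀ n, (X n).IsHermitian) (hP : ∀ n, (P n).IsHermitian)
    (hU : ∀ᶠ n in atTop, HasSpikes (P n) θ (U n)) (hz : ∀ᶠ n in atTop, lam (hX n) 1 < z)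
    (hK : Tendsto (fun n => compressedResolvent z (X n) (U n)) atTop (𝓝 ((g : 𝕜) • 1)))
    (hg : 0 < g) {k : ℕ} (hk : 1 ≤ k) (hkθ : k ≤ Fintype.card {j // 1 < θ j * g}) :
    ∀ᶠ n in atTop, z ≤ lam ((hX n).add (hP n)) k := by
  let J : Finset ι := {j | 1 < θ j * g}
  have hlim : Tendsto (fun n => (compressedResolvent z (X n) (U n) * diagonal (fun j => (θ j : 𝕜)) *
      compressedResolvent z (X n) (U n) - compressedResolvent z (X n) (U n)).submatrix
        ((↑) : J → ι) ((↑) : J → ι)) atTop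
          (𝓝 (diagonal fun j => ((g * (θ j * g - 1) : ℝ) : 𝕜))) := by
    have hcont : Continuous fun K : Matrix ι ι 𝕜 =>
        (K * diagonal (fun j => (θ j : 𝕜)) * K - K).submatrix ((↑) : J → ι) ((↑) : J → ι) := by
      fun_prop
    have h := (hcont.tendsto _).comp hK
    rw [smul_one_eq_diagonal, diagonal_mul_diagonal, diagonal_mul_diagonal, diagonal_sub,
      submatrix_diagonal _ _ Subtype.val_injective] at h
    convert h using 3
    · rfl
    · rfl
    · ext j
      simp only [Function.comp_apply, RCLike.ofReal_mul, RCLike.ofReal_sub, RCLike.ofReal_one]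
      ring
  have hpos (j : J) : 0 < g * (θ j * g - 1) :=
    mul_pos hg (sub_pos.mpr (Finset.mem_filter.mp j.2).2)
  have hherm (n) : ((compressedResolvent z (X n) (U n) * diagonal (fun j => (θ j : 𝕜)) *
      compressedResolvent z (X n) (U n) - compressedResolvent z (X n) (U n)).submatrix
        ((↑) : J → ι) ((↑) : J → ι)).IsHermitian := by
    have hKn := compressedResolvent_isHermitian (hX n) z (U n)
    have hθ : (diagonal fun j => (θ j : 𝕜)).IsHermitian := by
      simp [IsHermitian, diagonal_conjTranspose, Pi.star_def]
    have hKθK := isHermitian_conjTranspose_mul_mul (compressedResolvent z (X n) (U n)) hθ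
    rw [hKn.eq] at hKθK
    exact (hKθK.sub hKn).submatrix _
  filter_upwards [hU, hz, eventually_posSemidef hpos hherm hlim] with n hU hz hJ
  exact le_lam_add (hX n) (hP n) (posDef_smul_one_sub (hX n) hz) hU hk
    (by rwa [← Fintype.card_subtype]) hJ

theorem eventually_lam_add_le (hX : ∀ n, (X n).IsHermitian) (hP : ∀ n, (P n).IsHermitian)
    (hU : ∀ᶠ n in atTop, HasSpikes (P n) θ (U n)) (hz : ∀ᶠ n in atTop, lam (hX n) 1 < z)
    (hK : Tendsto (fun n => compressedResolvent z (X n) (U n)) atTop (𝓝 ((g : 𝕜) • 1)))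
    {k : ℕ} (hkθ : Fintype.card {j // 1 ≤ θ j * g} < k) :
    ∀ᶠ n in atTop, lam ((hX n).add (hP n)) k ≤ z := by
  let J : Finset ι := {j | 0 < θ j ∧ θ j * g < 1}
  have hlim : Tendsto (fun n => (diagonal (fun j => (θ j : 𝕜)⁻¹) -
      compressedResolvent z (X n) (U n)).submatrix ((↑) : J → ι) ((↑) : J → ι)) atTop
        (𝓝 (diagonal fun j => (((θ j)⁻¹ - g : ℝ) : 𝕜))) := by
    have hcont : Continuous fun K : Matrix ι ι 𝕜 =>
        (diagonal (fun j => (θ j : 𝕜)⁻¹) - K).submatrix ((↑) : J → ι) ((↑) : J → ι) := by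
      fun_prop
    have h := (hcont.tendsto _).comp hK
    rw [smul_one_eq_diagonal, diagonal_sub, submatrix_diagonal _ _ Subtype.val_injective] at h
    convert h using 3
    · rfl
    · rfl
    · ext j
      simp
  have hpos (j : J) : 0 < (θ j)⁻¹ - g := by
    obtain ⟨hj0, hj1⟩ := (Finset.mem_filter.mp j.2).2
    rw [sub_pos, ← one_div, lt_div_iff₀ hj0, mul_comm]
    exact hj1
  have hherm (n) : ((diagonal (fun j => (θ j : 𝕜)⁻¹) -
      compressedResolvent z (X n) (U n)).submatrix ((↑) : J → ι) ((↑) : J → ι)).IsHermitian := by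
    refine (IsHermitian.sub ?_ (compressedResolvent_isHermitian (hX n) z (U n))).submatrix _
    simp [IsHermitian, diagonal_conjTranspose, Pi.star_def]
  have hcard : Fintype.card {j // 0 < θ j ∧ j ∉ J} < k := by
    refine (Fintype.card_subtype_mono _ _ ?_).trans_lt hkθ
    rintro j ⟨hj, hjJ⟩
    simpa [J, hj] using hjJ
  filter_upwards [hU, hz, eventually_ge_atTop k, eventually_posSemidef hpos hherm hlim]
    with n hU hz hkn hJ
  exact lam_add_le (hX n) (hP n) (posDef_smul_one_sub (hX n) hz) hU
    (fun j hj => (Finset.mem_filter.mp hj).2.1) hkn hcard hJ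

theorem tendsto_lam_add (hX : ∀ n, (X n).IsHermitian) (hP : ∀ n, (P n).IsHermitian)
    (hU : ∀ᶠ n in atTop, HasSpikes (P n) θ (U n)) {b : ℝ} {G : ℝ → ℝ}
    (hb : ∀ k, 1 ≤ k → Tendsto (fun n => lam (hX n) k) atTop (𝓝 b))
    (hK : ∀ q : ℚ, b < q →
      Tendsto (fun n => compressedResolvent q (X n) (U n)) atTop (𝓝 ((G q : 𝕜) • 1)))
    (hG : ∀ z, b < z → 0 < G z) {k : ℕ} (hk : 1 ≤ k) {ℓ : ℝ} (hbℓ : b ≤ ℓ)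
    (hlow : ∀ z ∈ Set.Ioo b ℓ, k ≤ Fintype.card {j // 1 < θ j * G z})
    (hup : ∀ z, ℓ < z → Fintype.card {j // 1 ≤ θ j * G z} < k) :
    Tendsto (fun n => lam ((hX n).add (hP n)) k) atTop (𝓝 ℓ) := by
  have hlt {z : ℝ} (hz : b < z) : ∀ᶠ n in atTop, lam (hX n) 1 < z :=
    (hb 1 le_rfl).eventually (gt_mem_nhds hz)
  refine tendsto_order.mpr ⟨fun y hy => ?_, fun y hy => ?_⟩
  · rcases lt_or_ge y b with hyb | hyb
    · have hint := (hb (k + Fintype.card ι) (by omega)).eventually (lt_mem_nhds hyb)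
      filter_upwards [hU, hint, eventually_ge_atTop (k + Fintype.card ι)] with n hU hyn hkn
      exact hyn.trans_le (lam_add_card_le_lam_add (hX n) (hP n) hU hk hkn)
    · obtain ⟨q, hyq, hqℓ⟩ := exists_rat_btwn hy
      have hbq := hyb.trans_lt hyq
      filter_upwards [eventually_le_lam_add hX hP hU (hlt hbq) (hK q hbq) (hG q hbq) hk
        (hlow q ⟨hbq, hqℓ⟩)] with n hn
      exact hyq.trans_le hn
  · obtain ⟨q, hℓq, hqy⟩ := exists_rat_btwn hy
    have hbq := hbℓ.trans_lt hℓq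
    filter_upwards [eventually_lam_add_le hX hP hU (hlt hbq) (hK q hbq) (hup q hℓq)]
      with n hn
    exact hn.trans_lt hqy

end Asymptotics

section SignAverages

open Finset
open scoped BigOperators

variable {n : ℕ}

theorem expect_signs_succ (f : (Fin (n + 1) → ℤˣ) → ℝ) :
    𝔼 ε, f ε = (𝔼 ε, f (Fin.cons 1 ε) + 𝔼 ε, f (Fin.cons (-1) ε)) / 2 := by
  rw [← Fintype.expect_equiv (Fin.consEquiv fun _ => ℤˣ) (fun q => f (Fin.cons q.1 q.2)) f
    fun _ => rfl, ← univ_product_univ, expect_product, UnitsInt.univ,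
    expect_eq_sum_div_card, sum_pair (by decide), card_pair (by decide)]
  norm_cast

theorem expect_signs_linear_sq (a : Fin n → ℝ) :
    𝔼 ε : Fin n → ℤˣ, (∑ i, a i * (ε i : ℤ)) ^ 2 = ∑ i, a i ^ 2 := by
  induction n with
  | zero => simp
  | succ n ih =>
    rw [expect_signs_succ, Fin.sum_univ_succ, ← ih, ← expect_add_distrib, expect_div,
      ← Fintype.expect_const (ι := Fin n → ℤˣ) (a 0 ^ 2), ← expect_add_distrib]
    refine expect_congr rfl fun ε _ => ?_
    simp only [Fin.sum_univ_succ, Fin.cons_zero, Fin.cons_succ]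
    push_cast
    ring

theorem expect_signs_linear_pow_four_le (a : Fin n → ℝ) :
    𝔼 ε : Fin n → ℤˣ, (∑ i, a i * (ε i : ℤ)) ^ 4 ≤ 3 * (∑ i, a i ^ 2) ^ 2 := by
  induction n with
  | zero => simp
  | succ n ih =>
    have hsplit : 𝔼 ε : Fin (n + 1) → ℤˣ, (∑ i, a i * (ε i : ℤ)) ^ 4 =
        a 0 ^ 4 + 6 * a 0 ^ 2 * 𝔼 ε : Fin n → ℤˣ, (∑ i, a i.succ * (ε i : ℤ)) ^ 2 +
          𝔼 ε : Fin n → ℤˣ, (∑ i, a i.succ * (ε i : ℤ)) ^ 4 := by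
      rw [expect_signs_succ, mul_expect, ← expect_add_distrib, expect_div,
        ← Fintype.expect_const (ι := Fin n → ℤˣ) (a 0 ^ 4), ← expect_add_distrib,
        ← expect_add_distrib]
      refine expect_congr rfl fun ε _ => ?_
      simp only [Fin.sum_univ_succ, Fin.cons_zero, Fin.cons_succ]
      push_cast
      ring
    have hpow := ih fun i => a i.succ
    rw [hsplit, expect_signs_linear_sq, Fin.sum_univ_succ]
    nlinarith [sq_nonneg (a 0 ^ 2)]

theorem expect_add_pow_four_add_expect_sub_pow_four_le {ι : Type*} [Fintype ι] (L Q : ι → ℝ)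
    {α β : ℝ} (hα : 0 ≤ α) (hβ : 0 ≤ β) (hL : 𝔼 i, L i ^ 4 ≤ 3 * α ^ 2)
    (hQ : 𝔼 i, Q i ^ 4 ≤ 27 * β ^ 2) :
    (𝔼 i, (L i + Q i) ^ 4 + 𝔼 i, (-L i + Q i) ^ 4) / 2 ≤ 27 * (α + β) ^ 2 := by
  have hsplit : (𝔼 i, (L i + Q i) ^ 4 + 𝔼 i, (-L i + Q i) ^ 4) / 2 =
      𝔼 i, L i ^ 4 + 6 * 𝔼 i, L i ^ 2 * Q i ^ 2 + 𝔼 i, Q i ^ 4 := by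
    rw [mul_expect, ← expect_add_distrib, ← expect_add_distrib, ← expect_add_distrib, expect_div]
    exact expect_congr rfl fun i _ => by ring
  have hLQ : 𝔼 i, L i ^ 2 * Q i ^ 2 ≤ 9 * α * β := by
    refine abs_le_of_sq_le_sq' ?_ (by positivity) |>.2
    calc (𝔼 i, L i ^ 2 * Q i ^ 2) ^ 2 ≤ (𝔼 i, (L i ^ 2) ^ 2) * 𝔼 i, (Q i ^ 2) ^ 2 :=
          expect_mul_sq_le_sq_mul_sq _ _ _
      _ ≤ (3 * α ^ 2) * (27 * β ^ 2) := by
          simp only [← pow_mul]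
          exact mul_le_mul hL hQ (expect_nonneg fun i _ => even_two.mul_left 2 |>.pow_nonneg _)
            (by positivity)
      _ = (9 * α * β) ^ 2 := by ring
  rw [hsplit]
  nlinarith [sq_nonneg α]

theorem expect_signs_quadratic_pow_four_le (S : Matrix (Fin n) (Fin n) ℝ) :
    𝔼 ε : Fin n → ℤˣ, ((∑ i, ∑ j, S i j * (ε i : ℤ) * (ε j : ℤ)) - S.trace) ^ 4 ≤
      108 * (∑ i, ∑ j, S i j ^ 2) ^ 2 := by
  suffices h : 𝔼 ε : Fin n → ℤˣ, ((∑ i, ∑ j, S i j * (ε i : ℤ) * (ε j : ℤ)) - S.trace) ^ 4 ≤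
      27 * (2 * ∑ i, ∑ j, S i j ^ 2) ^ 2 from h.trans_eq (by ring)
  induction n with
  | zero => simp [Matrix.trace]
  | succ n ih =>
    let S' : Matrix (Fin n) (Fin n) ℝ := S.submatrix Fin.succ Fin.succ
    let a (i : Fin n) : ℝ := S 0 i.succ + S i.succ 0
    let L (ε : Fin n → ℤˣ) : ℝ := ∑ i, a i * (ε i : ℤ)
    let Q (ε : Fin n → ℤˣ) : ℝ := (∑ i, ∑ j, S' i j * (ε i : ℤ) * (ε j : ℤ)) - S'.trace
    have hcons (σ : ℤˣ) (ε : Fin n → ℤˣ) :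
        (∑ i, ∑ j, S i j * ((Fin.cons σ ε : Fin (n + 1) → ℤˣ) i : ℤ) *
          ((Fin.cons σ ε : Fin (n + 1) → ℤˣ) j : ℤ)) - S.trace = (σ : ℤ) * L ε + Q ε := by
      have hσ : ((σ : ℤ) : ℝ) * (σ : ℤ) = 1 := by
        rw [← Int.cast_mul, ← Units.val_mul, Int.units_mul_self, Units.val_one, Int.cast_one]
      simp only [L, Q, a, S', Matrix.trace, Fin.sum_univ_succ, Fin.cons_zero, Fin.cons_succ,
        sum_add_distrib, add_mul, mul_add, mul_sum, submatrix_apply, diag_apply, mul_assoc, hσ]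
      simp only [mul_left_comm ((σ : ℤ) : ℝ), mul_comm _ ((σ : ℤ) : ℝ)]
      ring
    rw [expect_signs_succ]
    simp only [hcons, Units.val_one, Int.cast_one, one_mul, Units.val_neg, Int.cast_neg, neg_mul]
    have ha : ∑ i, a i ^ 2 + 2 * ∑ i, ∑ j, S' i j ^ 2 ≤ 2 * ∑ i, ∑ j, S i j ^ 2 := by
      have hai : ∑ i, a i ^ 2 ≤
          2 * ∑ i : Fin n, S 0 i.succ ^ 2 + 2 * ∑ i : Fin n, S i.succ 0 ^ 2 := by
        rw [mul_sum, mul_sum, ← sum_add_distrib]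
        exact sum_le_sum fun i _ => by nlinarith [sq_nonneg (S 0 i.succ - S i.succ 0)]
      simp only [Fin.sum_univ_succ, sum_add_distrib, S', submatrix_apply]
      nlinarith [sq_nonneg (S 0 0)]
    have ha0 : 0 ≤ ∑ i, a i ^ 2 := by positivity
    have hS'0 : 0 ≤ 2 * ∑ i, ∑ j, S' i j ^ 2 := by positivity
    refine (expect_add_pow_four_add_expect_sub_pow_four_le L Q ha0 hS'0
      (expect_signs_linear_pow_four_le a) (ih S')).trans ?_
    gcongr

end SignAverages

section Frobenius

open scoped Matrix.Norms.Frobenius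

variable {l m n : Type*} [Fintype l] [Fintype m] [Fintype n]

theorem frobenius_norm_sq (A : Matrix m n 𝕜) : ‖A‖ ^ 2 = ∑ i, ∑ j, ‖A i j‖ ^ 2 := by
  rw [frobenius_norm_def, ← Real.sqrt_eq_rpow]
  simp only [Real.rpow_two]
  exact Real.sq_sqrt (by positivity)

theorem frobenius_norm_sq_eq_re_trace (A : Matrix m n 𝕜) :
    ‖A‖ ^ 2 = RCLike.re (Aᴴ * A).trace := by
  rw [frobenius_norm_sq, Finset.sum_comm, trace, map_sum]
  refine Finset.sum_congr rfl fun j _ => ?_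
  rw [diag_apply, mul_apply, map_sum]
  refine Finset.sum_congr rfl fun i _ => ?_
  rw [conjTranspose_apply, RCLike.star_def, RCLike.conj_mul]
  norm_cast

theorem frobenius_norm_mul_left [DecidableEq m] {U : Matrix l m 𝕜} (hU : Uᴴ * U = 1)
    (A : Matrix m n 𝕜) : ‖U * A‖ = ‖A‖ := by
  rw [← sq_eq_sq₀ (norm_nonneg _) (norm_nonneg _), frobenius_norm_sq_eq_re_trace,
    frobenius_norm_sq_eq_re_trace, conjTranspose_mul, Matrix.mul_assoc,
    ← Matrix.mul_assoc Uᴴ, hU, Matrix.one_mul]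

theorem frobenius_norm_conj [DecidableEq m] {U : Matrix l m 𝕜} (hU : Uᴴ * U = 1)
    (A : Matrix m m 𝕜) : ‖U * A * Uᴴ‖ = ‖A‖ := by
  rw [← frobenius_norm_conjTranspose, conjTranspose_mul, conjTranspose_conjTranspose,
    frobenius_norm_mul_left hU, frobenius_norm_conjTranspose, frobenius_norm_mul_left hU]

end Frobenius

section Haar

variable {n : ℕ}

instance instBorelSpaceMatrix : BorelSpace (Matrix (Fin n) (Fin n) 𝕜) :=
  inferInstanceAs (BorelSpace (Fin n → Fin n → 𝕜))

instance instSecondCountableTopologyMatrix :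
    SecondCountableTopology (Matrix (Fin n) (Fin n) 𝕜) :=
  inferInstanceAs (SecondCountableTopology (Fin n → Fin n → 𝕜))

instance instCompactSpaceUnitaryGroup : CompactSpace (unitaryGroup (Fin n) 𝕜) := by
  have hbox : IsCompact (Set.univ.pi fun _ : Fin n => Set.univ.pi fun _ : Fin n =>
      Metric.closedBall (0 : 𝕜) 1) :=
    isCompact_univ_pi fun _ => isCompact_univ_pi fun _ => isCompact_closedBall _ _
  refine isCompact_iff_compactSpace.mp
    (IsCompact.of_isClosed_subset (X := Matrix (Fin n) (Fin n) 𝕜) hbox isClosed_unitary ?_)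
  exact fun U hU i _ j _ => mem_closedBall_zero_iff.mpr (entry_norm_bound_of_unitary hU i j)

theorem exists_haar_unitaryGroup : ∃ ν : Measure (unitaryGroup (Fin n) 𝕜),
    IsProbabilityMeasure ν ∧ ν.IsMulLeftInvariant :=
  ⟨Measure.haarMeasure ⊤, ⟨by
    simpa using Measure.haarMeasure_self
      (K₀ := (⊤ : TopologicalSpace.PositiveCompacts (unitaryGroup (Fin n) 𝕜)))⟩, inferInstance⟩

theorem exists_unitary_mulVec_single (i : Fin n) {u : Fin n → 𝕜} (hu : ∑ j, ‖u j‖ ^ 2 = 1) :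
    ∃ W : unitaryGroup (Fin n) 𝕜, W.1 *ᵥ Pi.single i 1 = u := by
  have hu' : ‖WithLp.toLp 2 u‖ = 1 := by
    simp [EuclideanSpace.norm_eq, hu]
  obtain ⟨b, hb⟩ := Orthonormal.exists_orthonormalBasis_extension_of_card_eq
    (𝕜 := 𝕜) (E := EuclideanSpace 𝕜 (Fin n)) (ι := Fin n) (by simp)
    (v := fun _ => WithLp.toLp 2 u) (s := {i}) (by
      constructor
      · simp [hu']
      · exact fun j k hjk => absurd (Subsingleton.elim j k) hjk)
  refine ⟨⟨(EuclideanSpace.basisFun (Fin n) 𝕜).toBasis.toMatrix b,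
    (EuclideanSpace.basisFun (Fin n) 𝕜).toMatrix_orthonormalBasis_mem_unitary b⟩, ?_⟩
  ext j
  simp [Module.Basis.toMatrix_apply, hb i rfl]

theorem exists_eq_smul_unitary_mulVec_single (i : Fin n) (u : Fin n → 𝕜) :
    ∃ W : unitaryGroup (Fin n) 𝕜, u = (√(∑ j, ‖u j‖ ^ 2) : 𝕜) • W.1 *ᵥ Pi.single i 1 := by
  rcases eq_or_ne u 0 with rfl | hu
  · exact ⟨1, by simp⟩
  have hpos : 0 < ∑ j, ‖u j‖ ^ 2 := by
    obtain ⟨j, hj⟩ := Function.ne_iff.mp hu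
    exact Finset.sum_pos' (fun _ _ => by positivity)
      ⟨j, Finset.mem_univ j, pow_pos (norm_pos_iff.mpr hj) 2⟩
  have hs : (√(∑ j, ‖u j‖ ^ 2) : 𝕜) ≠ 0 := RCLike.ofReal_ne_zero.mpr (Real.sqrt_ne_zero'.mpr hpos)
  obtain ⟨W, hW⟩ := exists_unitary_mulVec_single i (u := (√(∑ j, ‖u j‖ ^ 2) : 𝕜)⁻¹ • u) (by
    simp only [Pi.smul_apply, norm_smul, mul_pow, ← Finset.mul_sum, norm_inv, RCLike.norm_ofReal,
      abs_of_nonneg (Real.sqrt_nonneg _), inv_pow, Real.sq_sqrt hpos.le]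
    exact inv_mul_cancel₀ hpos.ne')
  exact ⟨W, by rw [hW, smul_inv_smul₀ hs]⟩

theorem hform_smul (A : Matrix (Fin n) (Fin n) 𝕜) (c : ℝ) (u : Fin n → 𝕜) :
    hform A ((c : 𝕜) • u) = c ^ 2 * hform A u := by
  simp only [hform, mulVec_smul, star_smul, dotProduct_smul, smul_dotProduct, smul_eq_mul,
    RCLike.star_def, RCLike.conj_ofReal, RCLike.re_ofReal_mul]
  ring

theorem continuous_unitary_conj (H : Matrix (Fin n) (Fin n) 𝕜) :
    Continuous fun V : unitaryGroup (Fin n) 𝕜 => V.1 * H * V.1ᴴ :=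
  (continuous_subtype_val.mul continuous_const).mul continuous_subtype_val.matrix_conjTranspose

theorem continuous_hform (u : Fin n → 𝕜) :
    Continuous fun A : Matrix (Fin n) (Fin n) 𝕜 => hform A u :=
  RCLike.continuous_re.comp
    (continuous_const.dotProduct (continuous_id.matrix_mulVec continuous_const))

variable {ν : Measure (unitaryGroup (Fin n) 𝕜)}

theorem integrable_of_continuous [IsFiniteMeasure ν]
    {f : unitaryGroup (Fin n) 𝕜 → ℝ} (hf : Continuous f) :
    Integrable f ν :=
  hf.integrable_of_hasCompactSupport (HasCompactSupport.of_compactSpace f)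

variable [ν.IsMulLeftInvariant]

theorem integral_hform_unitary_mulVec (H : Matrix (Fin n) (Fin n) 𝕜) (u : Fin n → 𝕜)
    (W : unitaryGroup (Fin n) 𝕜) (f : ℝ → ℝ) :
    ∫ V, f (hform (V.1 * H * V.1ᴴ) (W.1 *ᵥ u)) ∂ν = ∫ V, f (hform (V.1 * H * V.1ᴴ) u) ∂ν := by
  rw [← integral_mul_left_eq_self (μ := ν) (fun V => f (hform (V.1 * H * V.1ᴴ) u)) W⁻¹]
  refine integral_congr_ae (.of_forall fun V => congrArg f ?_)
  rw [← hform_conjTranspose_mul_mul]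
  simp [Matrix.mul_assoc, star_eq_conjTranspose]

theorem integral_hform_pow_four (H : Matrix (Fin n) (Fin n) 𝕜) (i : Fin n) (u : Fin n → 𝕜) :
    ∫ V, hform (V.1 * H * V.1ᴴ) u ^ 4 ∂ν =
      (∑ j, ‖u j‖ ^ 2) ^ 4 * ∫ V, hform (V.1 * H * V.1ᴴ) (Pi.single i 1) ^ 4 ∂ν := by
  have hscale (c : ℝ) (w : Fin n → 𝕜) :
      ∫ V, hform (V.1 * H * V.1ᴴ) ((c : 𝕜) • w) ^ 4 ∂ν =
        (c ^ 2) ^ 4 * ∫ V, hform (V.1 * H * V.1ᴴ) w ^ 4 ∂ν := by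
    simp only [hform_smul, mul_pow, integral_const_mul]
  obtain ⟨W, hW⟩ := exists_eq_smul_unitary_mulVec_single i u
  conv_lhs => rw [hW]
  rw [hscale, Real.sq_sqrt (by positivity),
    integral_hform_unitary_mulVec H (Pi.single i 1) W fun x => x ^ 4]

theorem hform_intCast (A : Matrix (Fin n) (Fin n) 𝕜) (ε : Fin n → ℤ) :
    hform A (fun i => (ε i : 𝕜)) = ∑ i, ∑ j, A.map RCLike.re i j * ε i * ε j := by
  simp only [hform, dotProduct, mulVec, map_sum, Finset.mul_sum, Pi.star_apply, RCLike.star_def,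
    map_intCast, map_apply]
  refine Finset.sum_congr rfl fun i _ => Finset.sum_congr rfl fun j _ => ?_
  rw [← RCLike.ofReal_intCast (ε i), ← RCLike.ofReal_intCast (ε j), RCLike.re_ofReal_mul,
    mul_comm (A i j), RCLike.re_ofReal_mul]
  ring

open scoped Matrix.Norms.Frobenius BigOperators in
theorem expect_hform_signs_pow_four_le {A : Matrix (Fin n) (Fin n) 𝕜}
    (hA : RCLike.re A.trace = 0) :
    𝔼 ε : Fin n → ℤˣ, hform A (fun i => ((ε i : ℤ) : 𝕜)) ^ 4 ≤ 108 * (‖A‖ ^ 2) ^ 2 := by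
  have htr : (A.map RCLike.re).trace = 0 := by
    rw [← hA, trace, trace, map_sum]
    rfl
  have h := expect_signs_quadratic_pow_four_le (A.map RCLike.re)
  simp only [htr, sub_zero] at h
  simp only [hform_intCast]
  refine h.trans ?_
  rw [frobenius_norm_sq]
  gcongr 108 * (∑ i, ∑ j, ?_) ^ 2 with i _ j
  exact sq_le_sq' (neg_le_of_abs_le (RCLike.abs_re_le_norm (A i j)))
    (RCLike.re_le_norm (A i j))

open scoped Matrix.Norms.Frobenius BigOperators in
theorem integral_hform_pow_four_le [IsProbabilityMeasure ν] {H : Matrix (Fin n) (Fin n) 𝕜}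
    (hH : RCLike.re H.trace = 0) (u : Fin n → 𝕜) :
    ∫ V, hform (V.1 * H * V.1ᴴ) u ^ 4 ∂ν ≤
      108 * (‖H‖ ^ 2) ^ 2 / (n : ℝ) ^ 4 * (∑ j, ‖u j‖ ^ 2) ^ 4 := by
  rcases isEmpty_or_nonempty (Fin n) with _ | ⟨⟨i⟩⟩
  · simp [hform, dotProduct]
  have hn : (0 : ℝ) < n := mod_cast i.pos
  have hsigns (V : unitaryGroup (Fin n) 𝕜) :
      𝔼 ε : Fin n → ℤˣ, hform (V.1 * H * V.1ᴴ) (fun j => ((ε j : ℤ) : 𝕜)) ^ 4 ≤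
        108 * (‖H‖ ^ 2) ^ 2 := by
    have hV : V.1ᴴ * V.1 = 1 := V.2.1
    rw [← frobenius_norm_conj hV H]
    apply expect_hform_signs_pow_four_le
    rw [trace_mul_comm, ← Matrix.mul_assoc, hV, Matrix.one_mul, hH]
  have hone (ε : Fin n → ℤˣ) : ∑ j, ‖((ε j : ℤ) : 𝕜)‖ ^ 2 = n := by
    have habs (j : Fin n) : ‖((ε j : ℤ) : 𝕜)‖ = 1 := by
      rcases Int.units_eq_one_or (ε j) with h | h <;> simp [h]
    simp [habs]
  have havg : (n : ℝ) ^ 4 * ∫ V, hform (V.1 * H * V.1ᴴ) (Pi.single i 1) ^ 4 ∂ν ≤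
      108 * (‖H‖ ^ 2) ^ 2 := by
    calc _ = 𝔼 ε : Fin n → ℤˣ,
          ∫ V, hform (V.1 * H * V.1ᴴ) (fun j => ((ε j : ℤ) : 𝕜)) ^ 4 ∂ν := by
          rw [← Fintype.expect_const (ι := Fin n → ℤˣ) (_ * _)]
          refine Finset.expect_congr rfl fun ε _ => ?_
          rw [integral_hform_pow_four H i fun j => ((ε j : ℤ) : 𝕜), hone]
      _ = ∫ V, 𝔼 ε : Fin n → ℤˣ, hform (V.1 * H * V.1ᴴ) (fun j => ((ε j : ℤ) : 𝕜)) ^ 4 ∂ν := by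
          simp only [Finset.expect_eq_sum_div_card]
          rw [integral_div, integral_finsetSum]
          exact fun ε _ => integrable_of_continuous (((continuous_hform _).comp
            (continuous_unitary_conj H)).pow 4)
      _ ≤ ∫ _, 108 * (‖H‖ ^ 2) ^ 2 ∂ν := integral_mono_of_nonneg
          (.of_forall fun V => Finset.expect_nonneg fun _ _ => by positivity)
          (integrable_const _) (.of_forall hsigns)
      _ = 108 * (‖H‖ ^ 2) ^ 2 := by simp
  rw [integral_hform_pow_four H i u, mul_comm]
  gcongr
  rwa [le_div_iff₀' (by positivity)]

theorem hform_add_smul_sub_hform_sub_smul {A : Matrix (Fin n) (Fin n) 𝕜} (hA : A.IsHermitian)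
    (c : 𝕜) (u v : Fin n → 𝕜) :
    hform A (u + c • v) - hform A (u - c • v) = 4 * RCLike.re (c * (star u ⬝ᵥ A *ᵥ v)) := by
  have hswap : star v ⬝ᵥ A *ᵥ u = star (star u ⬝ᵥ A *ᵥ v) := by
    rw [← star_dotProduct_star, star_star, star_mulVec, hA.eq, dotProduct_mulVec, dotProduct_comm]
  simp only [hform, mulVec_add, mulVec_sub, mulVec_smul, star_add, star_sub, star_smul,
    dotProduct_add, add_dotProduct, dotProduct_sub, sub_dotProduct, dotProduct_smul,
    smul_dotProduct, smul_eq_mul, hswap, mul_add, mul_sub,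
    map_add, map_sub, RCLike.star_def]
  rw [← map_mul, RCLike.conj_re]
  ring

theorem norm_pow_four_le (x : 𝕜) :
    ‖x‖ ^ 4 ≤ 2 * (RCLike.re x ^ 4 + RCLike.re (RCLike.I * x) ^ 4) := by
  have h : ‖x‖ ^ 2 = RCLike.re x ^ 2 + RCLike.im x ^ 2 := by
    rw [RCLike.norm_sq_eq_def, sq, sq]
  rw [RCLike.I_mul_re]
  nlinarith [sq_nonneg (RCLike.re x ^ 2 - RCLike.im x ^ 2)]

theorem norm_dotProduct_mulVec_pow_four_le {A : Matrix (Fin n) (Fin n) 𝕜} (hA : A.IsHermitian)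
    (u v : Fin n → 𝕜) :
    ‖star u ⬝ᵥ A *ᵥ v‖ ^ 4 ≤
      (hform A (u + v) ^ 4 + hform A (u - v) ^ 4 +
        hform A (u + (RCLike.I : 𝕜) • v) ^ 4 + hform A (u - (RCLike.I : 𝕜) • v) ^ 4) / 16 := by
  have hdiff (a b x : ℝ) (h : a - b = 4 * x) : x ^ 4 ≤ (a ^ 4 + b ^ 4) / 32 := by
    have hconvex := Even.add_pow_le (n := 4) (by decide) (a := a) (b := -b)
    rw [← sub_eq_add_neg, h, mul_pow] at hconvex
    norm_num at hconvex
    linarith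
  have hone := hform_add_smul_sub_hform_sub_smul hA 1 u v
  simp only [one_smul, one_mul] at hone
  linarith [norm_pow_four_le (star u ⬝ᵥ A *ᵥ v), hdiff _ _ _ hone,
    hdiff _ _ _ (hform_add_smul_sub_hform_sub_smul hA RCLike.I u v)]

theorem sum_norm_add_sq_le {u v : Fin n → 𝕜} (hu : ∑ i, ‖u i‖ ^ 2 = 1) (hv : ∑ i, ‖v i‖ ^ 2 ≤ 1) :
    ∑ i, ‖(u + v) i‖ ^ 2 ≤ 4 := by
  calc ∑ i, ‖(u + v) i‖ ^ 2 ≤ ∑ i, 2 * (‖u i‖ ^ 2 + ‖v i‖ ^ 2) :=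
        Finset.sum_le_sum fun i _ => (pow_le_pow_left₀ (norm_nonneg _) (norm_add_le _ _) 2).trans
          add_sq_le
    _ ≤ 4 := by
        rw [← Finset.mul_sum, Finset.sum_add_distrib]
        linarith

open scoped Matrix.Norms.Frobenius in
theorem integral_norm_dotProduct_mulVec_pow_four_le [IsProbabilityMeasure ν]
    {H : Matrix (Fin n) (Fin n) 𝕜} (hH : H.IsHermitian) (htr : H.trace = 0) {u v : Fin n → 𝕜}
    (hu : ∑ i, ‖u i‖ ^ 2 = 1) (hv : ∑ i, ‖v i‖ ^ 2 = 1) :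
    ∫ V, ‖star u ⬝ᵥ (V.1 * H * V.1ᴴ) *ᵥ v‖ ^ 4 ∂ν ≤ 6912 * (‖H‖ ^ 2) ^ 2 / (n : ℝ) ^ 4 := by
  let q (w : Fin n → 𝕜) (V : unitaryGroup (Fin n) 𝕜) : ℝ := hform (V.1 * H * V.1ᴴ) w ^ 4
  have hq (w) : Integrable (q w) ν :=
    integrable_of_continuous (((continuous_hform w).comp (continuous_unitary_conj H)).pow 4)
  have hqle (c : 𝕜) (hc : ‖c‖ ≤ 1) : ∫ V, q (u + c • v) V ∂ν ≤
      108 * (‖H‖ ^ 2) ^ 2 / (n : ℝ) ^ 4 * 4 ^ 4 := by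
    refine (integral_hform_pow_four_le (by rw [htr, map_zero]) _).trans ?_
    gcongr
    refine sum_norm_add_sq_le hu ?_
    simp only [Pi.smul_apply, norm_smul, mul_pow, ← Finset.mul_sum, hv, mul_one]
    exact pow_le_one₀ (norm_nonneg c) hc
  have hI : ‖(RCLike.I : 𝕜)‖ ≤ 1 := by
    rw [RCLike.norm_I]
    split_ifs <;> norm_num
  calc ∫ V, ‖star u ⬝ᵥ (V.1 * H * V.1ᴴ) *ᵥ v‖ ^ 4 ∂ν
      ≤ ∫ V, (q (u + (1 : 𝕜) • v) + q (u + (-1 : 𝕜) • v) + q (u + (RCLike.I : 𝕜) • v) +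
          q (u + (-RCLike.I : 𝕜) • v)) V / 16 ∂ν := by
        refine integral_mono_of_nonneg (.of_forall fun V => by positivity) ?_
          (.of_forall fun V => ?_)
        · exact ((((hq _).add (hq _)).add (hq _)).add (hq _)).div_const 16
        · simpa [q, sub_eq_add_neg] using
            norm_dotProduct_mulVec_pow_four_le (isHermitian_mul_mul_conjTranspose V.1 hH) u v
    _ ≤ 6912 * (‖H‖ ^ 2) ^ 2 / (n : ℝ) ^ 4 := by
        rw [integral_div, integral_add' (((hq _).add (hq _)).add (hq _)) (hq _),
          integral_add' ((hq _).add (hq _)) (hq _), integral_add' (hq _) (hq _)]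
        refine (div_le_div_of_nonneg_right (add_le_add (add_le_add (add_le_add
          (hqle 1 (by simp)) (hqle (-1) (by simp))) (hqle _ hI)) (hqle _ (by rwa [norm_neg])))
          (by norm_num)).trans_eq (by ring)

end Haar

section CompressionRatio

open scoped Matrix.Norms.Frobenius

variable {n : ℕ} {ι : Type*} [Fintype ι] [DecidableEq ι] {P H : Matrix (Fin n) (Fin n) 𝕜}
  {θ : ι → ℝ} {U : Matrix (Fin n) ι 𝕜} {ν : Measure (unitaryGroup (Fin n) 𝕜)}

/-- The share of the squared Frobenius norm of `H` that survives in `P H P`. -/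
noncomputable def compressionRatio (H P : Matrix (Fin n) (Fin n) 𝕜) : ℝ :=
  ‖P * H * P‖ ^ 2 / ‖H‖ ^ 2

theorem compressionRatio_conj (V : unitaryGroup (Fin n) 𝕜) (H P : Matrix (Fin n) (Fin n) 𝕜) :
    compressionRatio (V.1 * H * V.1ᴴ) (V.1 * P * V.1ᴴ) = compressionRatio H P := by
  have hV : V.1ᴴ * V.1 = 1 := V.2.1
  have hmul (A B : Matrix (Fin n) (Fin n) 𝕜) :
      V.1 * A * V.1ᴴ * (V.1 * B * V.1ᴴ) = V.1 * (A * B) * V.1ᴴ := by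
    linear_combination (norm := noncomm_ring) V.1 * A * hV * B * V.1ᴴ
  simp only [compressionRatio, hmul, frobenius_norm_conj hV]

theorem HasSpikes.frobenius_norm_mul_mul_sq (hU : HasSpikes P θ U)
    (H : Matrix (Fin n) (Fin n) 𝕜) :
    ‖P * H * P‖ ^ 2 = ∑ p : ι × ι, (θ p.1 * θ p.2) ^ 2 * ‖(Uᴴ * H * U) p.1 p.2‖ ^ 2 := by
  have hfactor : P * H * P =
      U * (diagonal (fun j => (θ j : 𝕜)) * (Uᴴ * H * U) * diagonal fun j => (θ j : 𝕜)) * Uᴴ := by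
    conv_lhs => rw [hU.eq_conj_diagonal]
    simp only [Matrix.mul_assoc]
  rw [hfactor, frobenius_norm_conj hU.conjTranspose_mul_self, frobenius_norm_sq,
    ← Fintype.sum_prod_type']
  refine Finset.sum_congr rfl fun p _ => ?_
  rw [mul_diagonal, diagonal_mul, norm_mul, norm_mul, RCLike.norm_ofReal, RCLike.norm_ofReal]
  simp only [mul_pow, sq_abs]
  ring

omit [Fintype ι] [DecidableEq ι] in
theorem conjTranspose_mul_mul_apply (H : Matrix (Fin n) (Fin n) 𝕜) (U : Matrix (Fin n) ι 𝕜)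
    (i j : ι) : (Uᴴ * H * U) i j = star (U.col i) ⬝ᵥ H *ᵥ U.col j := by
  rw [Matrix.mul_assoc, mul_apply']
  rfl

theorem HasSpikes.sum_norm_col_sq (hU : HasSpikes P θ U) (j : ι) : ∑ i, ‖U.col j i‖ ^ 2 = 1 := by
  have h := congrFun₂ hU.conjTranspose_mul_self j j
  simp only [mul_apply, conjTranspose_apply, one_apply_eq, RCLike.star_def, RCLike.conj_mul] at h
  exact_mod_cast h

theorem HasSpikes.frobenius_norm_mul_mul_pow_four_le (hU : HasSpikes P θ U)
    (H : Matrix (Fin n) (Fin n) 𝕜) :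
    ‖P * H * P‖ ^ 4 ≤ (Fintype.card ι : ℝ) ^ 2 *
      ∑ p : ι × ι, (θ p.1 * θ p.2) ^ 4 * ‖star (U.col p.1) ⬝ᵥ H *ᵥ U.col p.2‖ ^ 4 := by
  calc ‖P * H * P‖ ^ 4
      = (∑ p : ι × ι, (θ p.1 * θ p.2) ^ 2 * ‖(Uᴴ * H * U) p.1 p.2‖ ^ 2) ^ 2 := by
        rw [← hU.frobenius_norm_mul_mul_sq, ← pow_mul]
    _ ≤ Fintype.card (ι × ι) *
          ∑ p : ι × ι, ((θ p.1 * θ p.2) ^ 2 * ‖(Uᴴ * H * U) p.1 p.2‖ ^ 2) ^ 2 :=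
        sq_sum_le_card_mul_sum_sq
    _ = _ := by
        simp only [Fintype.card_prod, conjTranspose_mul_mul_apply]
        push_cast
        rw [← sq]
        congr! 2 with p
        ring

/-- A constant `C` for which `compressionRatio (V H V*) P` has second moment at most `C / n ^ 4`
when `V` is Haar distributed, `H` is traceless and `P` has the non-zero eigenvalues `θ`. -/
noncomputable def ratioConst (θ : ι → ℝ) : ℝ :=
  6912 * (Fintype.card ι : ℝ) ^ 2 * ∑ p : ι × ι, (θ p.1 * θ p.2) ^ 4

theorem HasSpikes.integral_compressionRatio_sq_le [IsProbabilityMeasure ν]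
    [ν.IsMulLeftInvariant] (hU : HasSpikes P θ U) (hH : H.IsHermitian) (htr : H.trace = 0) :
    ∫ V, compressionRatio (V.1 * H * V.1ᴴ) P ^ 2 ∂ν ≤ ratioConst θ / (n : ℝ) ^ 4 := by
  rcases eq_or_ne ‖H‖ 0 with h0 | h0
  · have hzero (V : unitaryGroup (Fin n) 𝕜) : compressionRatio (V.1 * H * V.1ᴴ) P = 0 := by
      simp [compressionRatio, norm_eq_zero.mp h0]
    simp only [hzero, ratioConst]
    simp only [ne_eq, OfNat.ofNat_ne_zero, not_false_eq_true, zero_pow, integral_zero]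
    positivity
  let f (p : ι × ι) (V : unitaryGroup (Fin n) 𝕜) : ℝ :=
    ‖star (U.col p.1) ⬝ᵥ (V.1 * H * V.1ᴴ) *ᵥ U.col p.2‖ ^ 4
  have hf (p) : Integrable (f p) ν := integrable_of_continuous
    ((continuous_const.dotProduct
      ((continuous_unitary_conj H).matrix_mulVec continuous_const)).norm.pow 4)
  have hfle (p) : ∫ V, f p V ∂ν ≤ 6912 * (‖H‖ ^ 2) ^ 2 / (n : ℝ) ^ 4 :=
    integral_norm_dotProduct_mulVec_pow_four_le hH htr (hU.sum_norm_col_sq _)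
      (hU.sum_norm_col_sq _)
  calc ∫ V, compressionRatio (V.1 * H * V.1ᴴ) P ^ 2 ∂ν
      ≤ ∫ V, (Fintype.card ι : ℝ) ^ 2 / ‖H‖ ^ 4 *
          ∑ p : ι × ι, (θ p.1 * θ p.2) ^ 4 * f p V ∂ν := by
        refine integral_mono_of_nonneg (.of_forall fun V => sq_nonneg _) ?_
          (.of_forall fun V => ?_)
        · exact (integrable_finsetSum _ fun p _ => (hf p).const_mul _).const_mul _
        · have hV : V.1ᴴ * V.1 = 1 := V.2.1
          simp only [compressionRatio, frobenius_norm_conj hV, div_pow, ← pow_mul]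
          rw [div_mul_eq_mul_div]
          exact div_le_div_of_nonneg_right (hU.frobenius_norm_mul_mul_pow_four_le _)
            (by positivity)
    _ = (Fintype.card ι : ℝ) ^ 2 / ‖H‖ ^ 4 *
          ∑ p : ι × ι, (θ p.1 * θ p.2) ^ 4 * ∫ V, f p V ∂ν := by
        rw [integral_const_mul, integral_finsetSum _ fun p _ => (hf p).const_mul _]
        simp only [integral_const_mul]
    _ ≤ (Fintype.card ι : ℝ) ^ 2 / ‖H‖ ^ 4 *
          ∑ p : ι × ι, (θ p.1 * θ p.2) ^ 4 * (6912 * (‖H‖ ^ 2) ^ 2 / (n : ℝ) ^ 4) := by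
        gcongr with p
        exact hfle p
    _ = ratioConst θ / (n : ℝ) ^ 4 := by
        rw [← Finset.sum_mul, ratioConst]
        field_simp

end CompressionRatio

section CenteredResolvent

variable {n : ℕ}

/-- The traceless part of the resolvent `(z - X)⁻¹`. -/
noncomputable def centeredResolvent (z : ℝ) (X : Matrix (Fin n) (Fin n) 𝕜) :
    Matrix (Fin n) (Fin n) 𝕜 :=
  matrixResolvent z X - ((matrixResolvent z X).trace / n) • 1

theorem trace_centeredResolvent (z : ℝ) (X : Matrix (Fin n) (Fin n) 𝕜) :
    (centeredResolvent z X).trace = 0 := by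
  rcases eq_or_ne n 0 with rfl | hn
  · exact Finset.sum_of_isEmpty _
  · rw [centeredResolvent, trace_sub, trace_smul, trace_one, Fintype.card_fin, smul_eq_mul,
      div_mul_cancel₀ _ (Nat.cast_ne_zero.mpr hn), sub_self]

theorem centeredResolvent_isHermitian {X : Matrix (Fin n) (Fin n) 𝕜} (hX : X.IsHermitian) (z : ℝ) :
    (centeredResolvent z X).IsHermitian := by
  have hR := matrixResolvent_isHermitian hX z
  refine hR.sub ?_
  have htr : star (matrixResolvent z X).trace = (matrixResolvent z X).trace := by
    rw [← trace_conjTranspose, hR.eq]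
  rw [IsHermitian, conjTranspose_smul, conjTranspose_one, star_div₀, htr, star_natCast]

theorem matrixResolvent_conj (V : unitaryGroup (Fin n) 𝕜) (z : ℝ)
    (X : Matrix (Fin n) (Fin n) 𝕜) :
    matrixResolvent z (V.1 * X * V.1ᴴ) = V.1 * matrixResolvent z X * V.1ᴴ := by
  have hV : V.1⁻¹ = V.1ᴴ := inv_eq_left_inv V.2.1
  have hV' : (V.1ᴴ)⁻¹ = V.1 := inv_eq_left_inv V.2.2
  rw [matrixResolvent, smul_one_eq_conj V, ← sub_mul, ← mul_sub, Matrix.mul_inv_rev,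
    Matrix.mul_inv_rev, hV, hV', ← Matrix.mul_assoc, matrixResolvent]

theorem centeredResolvent_conj (V : unitaryGroup (Fin n) 𝕜) (z : ℝ)
    (X : Matrix (Fin n) (Fin n) 𝕜) :
    centeredResolvent z (V.1 * X * V.1ᴴ) = V.1 * centeredResolvent z X * V.1ᴴ := by
  have hV : V.1ᴴ * V.1 = 1 := V.2.1
  rw [centeredResolvent, matrixResolvent_conj, trace_mul_comm, ← Matrix.mul_assoc, hV, one_mul,
    smul_one_eq_conj V, ← sub_mul, ← mul_sub, centeredResolvent]

theorem measurable_matrix_inv : Measurable fun A : Matrix (Fin n) (Fin n) 𝕜 => A⁻¹ := by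
  refine measurable_pi_lambda _ fun i => measurable_pi_lambda _ fun j => ?_
  simp only [Matrix.inv_def, Ring.inverse_eq_inv', Matrix.smul_apply, smul_eq_mul]
  exact continuous_id.matrix_det.measurable.inv.mul
    (continuous_id.matrix_adjugate.matrix_elem i j).measurable

theorem measurable_centeredResolvent (z : ℝ) :
    Measurable fun X : Matrix (Fin n) (Fin n) 𝕜 => centeredResolvent z X := by
  have hcenter : Continuous fun A : Matrix (Fin n) (Fin n) 𝕜 => A - (A.trace / n) • 1 :=
    continuous_id.sub ((continuous_id.matrix_trace.div_const _).smul continuous_const)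
  exact hcenter.measurable.comp
    (measurable_matrix_inv.comp (continuous_const.sub continuous_id).measurable)

theorem matrixResolvent_eq_conj_diagonal {X : Matrix (Fin n) (Fin n) 𝕜}
    {W : unitaryGroup (Fin n) 𝕜} {d : Fin n → ℝ}
    (hX : X = W.1 * diagonal (fun i => (d i : 𝕜)) * W.1ᴴ) {z : ℝ} (hz : ∀ i, z ≠ d i) :
    matrixResolvent z X = W.1 * diagonal (fun i => ((1 / (z - d i) : ℝ) : 𝕜)) * W.1ᴴ := by
  have hW : W.1 * W.1ᴴ = 1 := W.2.2
  have hW' : W.1ᴴ * W.1 = 1 := W.2.1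
  refine inv_eq_right_inv ?_
  have hdiag : diagonal (fun i => ((z - d i : ℝ) : 𝕜)) *
      diagonal (fun i => ((1 / (z - d i) : ℝ) : 𝕜)) = 1 := by
    rw [diagonal_mul_diagonal, ← diagonal_one]
    congr 1 with i
    rw [← RCLike.ofReal_mul, mul_one_div_cancel (sub_ne_zero.mpr (hz i)), RCLike.ofReal_one]
  rw [smul_one_sub_eq_conj_diagonal hX z]
  linear_combination (norm := noncomm_ring)
    W.1 * diagonal (fun i => ((z - d i : ℝ) : 𝕜)) * hW' *
      diagonal (fun i => ((1 / (z - d i) : ℝ) : 𝕜)) * W.1ᴴ + W.1 * hdiag * W.1ᴴ + hW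

variable {X : Matrix (Fin n) (Fin n) 𝕜} {z δ : ℝ}

theorem exists_unitary_matrixResolvent_eq (hX : X.IsHermitian) (hz : lam hX 1 < z) :
    ∃ W : unitaryGroup (Fin n) 𝕜, matrixResolvent z X =
      W.1 * diagonal (fun i : Fin n => ((1 / (z - lam hX (i + 1)) : ℝ) : 𝕜)) * W.1ᴴ := by
  obtain ⟨W, hW⟩ := exists_unitary_diagonalization hX
  exact ⟨W, matrixResolvent_eq_conj_diagonal hW fun i => ((lam_le_lam_one hX i).trans_lt hz).ne'⟩

theorem trace_matrixResolvent (hX : X.IsHermitian) (hz : lam hX 1 < z) :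
    (matrixResolvent z X).trace = ((∑ i : Fin n, 1 / (z - lam hX (i + 1)) : ℝ) : 𝕜) := by
  obtain ⟨W, hW⟩ := exists_unitary_matrixResolvent_eq hX hz
  have hW' : W.1ᴴ * W.1 = 1 := W.2.1
  rw [hW, trace_mul_comm, ← Matrix.mul_assoc, hW', one_mul, trace_diagonal, RCLike.ofReal_sum]

open scoped Matrix.Norms.Frobenius in
theorem frobenius_norm_centeredResolvent_sq_le (hX : X.IsHermitian) (hδ : 0 < δ)
    (hz : lam hX 1 < z - δ) : ‖centeredResolvent z X‖ ^ 2 ≤ n / δ ^ 2 := by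
  have hz' : lam hX 1 < z := hz.trans (sub_lt_self z hδ)
  obtain ⟨W, hW⟩ := exists_unitary_matrixResolvent_eq hX hz'
  let d (i : Fin n) : ℝ := 1 / (z - lam hX (i + 1))
  have hd (i) : d i ∈ Set.Icc 0 (1 / δ) := by
    have hi : δ ≤ z - lam hX (i + 1) := by linarith [lam_le_lam_one hX i]
    exact ⟨one_div_nonneg.mpr (hδ.le.trans hi), one_div_le_one_div_of_le hδ hi⟩
  have hmean : (∑ i, d i) / n ∈ Set.Icc 0 (1 / δ) := by
    refine ⟨div_nonneg (Finset.sum_nonneg fun i _ => (hd i).1) n.cast_nonneg,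
      div_le_of_le_mul₀ n.cast_nonneg (by positivity) ?_⟩
    simpa [mul_comm] using Finset.sum_le_card_nsmul Finset.univ d _ fun i _ => (hd i).2
  have hcentered : centeredResolvent z X =
      W.1 * diagonal (fun i => ((d i - (∑ i, d i) / n : ℝ) : 𝕜)) * W.1ᴴ := by
    rw [centeredResolvent, trace_matrixResolvent hX hz', hW, smul_one_eq_conj W,
      ← sub_mul, ← mul_sub, smul_one_eq_diagonal, diagonal_sub]
    simp only [d, RCLike.ofReal_sub, RCLike.ofReal_div, RCLike.ofReal_natCast]
  have hW' : W.1ᴴ * W.1 = 1 := W.2.1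
  rw [hcentered, frobenius_norm_conj hW', frobenius_norm_diagonal, EuclideanSpace.norm_sq_eq]
  calc ∑ i, ‖((d i - (∑ i, d i) / n : ℝ) : 𝕜)‖ ^ 2
      = ∑ i, |d i - (∑ i, d i) / n| ^ 2 := by simp only [RCLike.norm_ofReal]
    _ ≤ ∑ _ : Fin n, (1 / δ) ^ 2 := by
        gcongr with i
        exact abs_sub_le_iff.mpr ⟨by linarith [(hd i).2, hmean.1], by linarith [(hd i).1, hmean.2]⟩
    _ = n / δ ^ 2 := by simp [div_eq_mul_inv]

theorem compressedResolvent_eq_add {ι : Type*} [DecidableEq ι]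
    {U : Matrix (Fin n) ι 𝕜} (hU : Uᴴ * U = 1) (z : ℝ) (X : Matrix (Fin n) (Fin n) 𝕜) :
    compressedResolvent z X U =
      Uᴴ * centeredResolvent z X * U + ((matrixResolvent z X).trace / n) • 1 := by
  rw [centeredResolvent, Matrix.mul_sub, Matrix.sub_mul, Matrix.mul_smul, Matrix.smul_mul,
    Matrix.mul_one, hU, sub_add_cancel, compressedResolvent]

end CenteredResolvent

section Concentration

variable {ι : Type*} [Fintype ι] [DecidableEq ι] {θ : ι → ℝ}
  {X P : (n : ℕ) → Matrix (Fin n) (Fin n) 𝕜} {U : (n : ℕ) → Matrix (Fin n) ι 𝕜} {z δ G : ℝ}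

open scoped Matrix.Norms.Frobenius in
theorem HasSpikes.norm_conjTranspose_mul_mul_apply_sq_le {n : ℕ}
    {P H : Matrix (Fin n) (Fin n) 𝕜} {U : Matrix (Fin n) ι 𝕜} (hU : HasSpikes P θ U) (i j : ι) :
    (θ i * θ j) ^ 2 * ‖(Uᴴ * H * U) i j‖ ^ 2 ≤ compressionRatio H P * ‖H‖ ^ 2 := by
  rw [compressionRatio, div_mul_cancel_of_imp fun h => by simp_all, hU.frobenius_norm_mul_mul_sq]
  exact Finset.single_le_sum (f := fun p : ι × ι => (θ p.1 * θ p.2) ^ 2 *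
    ‖(Uᴴ * H * U) p.1 p.2‖ ^ 2) (fun p _ => by positivity) (Finset.mem_univ (i, j))

theorem tendsto_conj_centeredResolvent (hX : ∀ n, (X n).IsHermitian)
    (hU : ∀ᶠ n in atTop, HasSpikes (P n) θ (U n)) (hθ : ∀ j, θ j ≠ 0) (hδ : 0 < δ)
    (hz : ∀ᶠ n in atTop, lam (hX n) 1 < z - δ)
    (hratio : Tendsto (fun n : ℕ => n * compressionRatio (centeredResolvent z (X n)) (P n))
      atTop (𝓝 0)) :
    Tendsto (fun n => (U n)ᴴ * centeredResolvent z (X n) * U n) atTop (𝓝 0) := by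
  refine tendsto_pi_nhds.mpr fun i => tendsto_pi_nhds.mpr fun j => ?_
  have hij : 0 < (θ i * θ j) ^ 2 := sq_pos_of_ne_zero (mul_ne_zero (hθ i) (hθ j))
  have hbound : Tendsto (fun n : ℕ => n * compressionRatio (centeredResolvent z (X n)) (P n) /
      (δ ^ 2 * (θ i * θ j) ^ 2)) atTop (𝓝 0) := by
    simpa using hratio.div_const (δ ^ 2 * (θ i * θ j) ^ 2)
  have hsq : Tendsto (fun n => ‖((U n)ᴴ * centeredResolvent z (X n) * U n) i j‖ ^ 2)
      atTop (𝓝 0) := by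
    refine squeeze_zero' (.of_forall fun n => by positivity) ?_ hbound
    filter_upwards [hU, hz] with n hUn hzn
    rw [← div_div, le_div_iff₀' hij]
    refine (hUn.norm_conjTranspose_mul_mul_apply_sq_le i j).trans ?_
    refine (mul_le_mul_of_nonneg_left (frobenius_norm_centeredResolvent_sq_le (hX n) hδ hzn)
      (by unfold compressionRatio; positivity)).trans_eq ?_
    ring
  exact tendsto_zero_iff_norm_tendsto_zero.mpr (by simpa [Real.sqrt_sq] using hsq.sqrt)

theorem tendsto_compressedResolvent (hX : ∀ n, (X n).IsHermitian)
    (hU : ∀ᶠ n in atTop, HasSpikes (P n) θ (U n)) (hθ : ∀ j, θ j ≠ 0) (hδ : 0 < δ)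
    (hz : ∀ᶠ n in atTop, lam (hX n) 1 < z - δ)
    (hmean : Tendsto (fun n : ℕ => (n : ℝ)⁻¹ * ∑ i : Fin n, 1 / (z - lam (hX n) (i + 1))) atTop
      (𝓝 G))
    (hratio : Tendsto (fun n : ℕ => n * compressionRatio (centeredResolvent z (X n)) (P n))
      atTop (𝓝 0)) :
    Tendsto (fun n => compressedResolvent z (X n) (U n)) atTop (𝓝 ((G : 𝕜) • 1)) := by
  have htrace : Tendsto (fun n => ((matrixResolvent z (X n)).trace / n) • (1 : Matrix ι ι 𝕜))
      atTop (𝓝 ((G : 𝕜) • 1)) := by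
    refine Tendsto.smul_const ?_ _
    refine ((RCLike.continuous_ofReal.tendsto G).comp hmean).congr' ?_
    filter_upwards [hz] with n hzn
    rw [trace_matrixResolvent (hX n) (hzn.trans (sub_lt_self z hδ)), Function.comp_apply,
      inv_mul_eq_div, RCLike.ofReal_div, RCLike.ofReal_natCast]
  rw [← zero_add ((G : 𝕜) • (1 : Matrix ι ι 𝕜))]
  refine ((tendsto_conj_centeredResolvent hX hU hθ hδ hz hratio).add htrace).congr' ?_
  filter_upwards [hU] with n hUn
  exact (compressedResolvent_eq_add hUn.conjTranspose_mul_self z (X n)).symm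

end Concentration

section ConjInvariance

variable {n : ℕ} {Ω : Type*} [MeasurableSpace Ω] {Pr : Measure Ω}
  {X P : Ω → Matrix (Fin n) (Fin n) 𝕜}

theorem measurable_conj (V : Matrix (Fin n) (Fin n) 𝕜) :
    Measurable fun A : Matrix (Fin n) (Fin n) 𝕜 => V * A * Vᴴ :=
  ((continuous_const.mul continuous_id).mul continuous_const).measurable

theorem IsConjInvariant.neg (hX : Measurable X) (h : IsConjInvariant X Pr) :
    IsConjInvariant (fun ω => -X ω) Pr := by
  intro U hU
  have hneg : Measurable fun A : Matrix (Fin n) (Fin n) 𝕜 => -A := continuous_neg.measurable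
  have hmap := congrArg (Measure.map fun A : Matrix (Fin n) (Fin n) 𝕜 => -A) (h U hU)
  have hconj : Measurable fun ω => U * X ω * star U := (measurable_conj U).comp hX
  rw [Measure.map_map hneg hconj, Measure.map_map hneg hX] at hmap
  simpa only [Function.comp_def, mul_neg, neg_mul] using hmap

variable [IsProbabilityMeasure Pr]

theorem lintegral_conj_left_eq (hX : Measurable X) (hP : Measurable P) (hindep : IndepFun X P Pr)
    (hinv : IsConjInvariant X Pr ∨ IsConjInvariant P Pr)
    {f : Matrix (Fin n) (Fin n) 𝕜 × Matrix (Fin n) (Fin n) 𝕜 → ℝ≥0∞} (hf : Measurable f)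
    (hconj : ∀ (V : unitaryGroup (Fin n) 𝕜) A B, f (V.1 * A * V.1ᴴ, V.1 * B * V.1ᴴ) = f (A, B))
    (V : unitaryGroup (Fin n) 𝕜) :
    ∫⁻ ω, f (V.1 * X ω * V.1ᴴ, P ω) ∂Pr = ∫⁻ ω, f (X ω, P ω) ∂Pr := by
  have hlaw {X' P' : Ω → Matrix (Fin n) (Fin n) 𝕜} (hX' : Measurable X') (hP' : Measurable P')
      (h : IndepFun X' P' Pr) :
      ∫⁻ ω, f (X' ω, P' ω) ∂Pr = ∫⁻ q, f q ∂(Pr.map X').prod (Pr.map P') := by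
    rw [← (indepFun_iff_map_prod_eq_prod_map_map hX'.aemeasurable hP'.aemeasurable).mp h,
      lintegral_map hf (hX'.prodMk hP')]
  have hmeas (W : unitaryGroup (Fin n) 𝕜) := measurable_conj (W.1 : Matrix (Fin n) (Fin n) 𝕜)
  rcases hinv with h | h
  · calc ∫⁻ ω, f (V.1 * X ω * V.1ᴴ, P ω) ∂Pr
        = ∫⁻ q, f q ∂(Pr.map fun ω => V.1 * X ω * V.1ᴴ).prod (Pr.map P) :=
          hlaw ((hmeas V).comp hX) hP (hindep.comp (hmeas V) measurable_id)
      _ = ∫⁻ q, f q ∂(Pr.map X).prod (Pr.map P) :=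
          congrArg (fun ρ => ∫⁻ q, f q ∂ρ.prod (Pr.map P)) (h V V.2)
      _ = ∫⁻ ω, f (X ω, P ω) ∂Pr := (hlaw hX hP hindep).symm
  · have hcancel (ω : Ω) :
        f (V.1 * X ω * V.1ᴴ, P ω) = f (X ω, (V⁻¹).1 * P ω * (V⁻¹).1ᴴ) := by
      have hV : V.1 * V.1ᴴ = 1 := V.2.2
      rw [← hconj V (X ω), UnitaryGroup.inv_val, star_eq_conjTranspose,
        conjTranspose_conjTranspose]
      congr 2
      linear_combination (norm := noncomm_ring) -P ω * hV - hV * P ω * V.1 * V.1ᴴ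
    calc ∫⁻ ω, f (V.1 * X ω * V.1ᴴ, P ω) ∂Pr
        = ∫⁻ ω, f (X ω, (V⁻¹).1 * P ω * (V⁻¹).1ᴴ) ∂Pr := by simp only [hcancel]
      _ = ∫⁻ q, f q ∂(Pr.map X).prod (Pr.map fun ω => (V⁻¹).1 * P ω * (V⁻¹).1ᴴ) :=
          hlaw hX ((hmeas V⁻¹).comp hP) (hindep.comp measurable_id (hmeas V⁻¹))
      _ = ∫⁻ q, f q ∂(Pr.map X).prod (Pr.map P) :=
          congrArg (fun ρ => ∫⁻ q, f q ∂(Pr.map X).prod ρ) (h _ (V⁻¹).2)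
      _ = ∫⁻ ω, f (X ω, P ω) ∂Pr := (hlaw hX hP hindep).symm

theorem lintegral_le_of_lintegral_conj_le (hX : Measurable X) (hP : Measurable P)
    (hindep : IndepFun X P Pr) (hinv : IsConjInvariant X Pr ∨ IsConjInvariant P Pr)
    {f : Matrix (Fin n) (Fin n) 𝕜 × Matrix (Fin n) (Fin n) 𝕜 → ℝ≥0∞} (hf : Measurable f)
    (hconj : ∀ (V : unitaryGroup (Fin n) 𝕜) A B, f (V.1 * A * V.1ᴴ, V.1 * B * V.1ᴴ) = f (A, B))
    (ν : Measure (unitaryGroup (Fin n) 𝕜)) [IsProbabilityMeasure ν] {C : ℝ≥0∞}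
    (hC : ∀ᵐ ω ∂Pr, ∫⁻ V, f (V.1 * X ω * V.1ᴴ, P ω) ∂ν ≤ C) :
    ∫⁻ ω, f (X ω, P ω) ∂Pr ≤ C := by
  have hmeas : Measurable fun q : unitaryGroup (Fin n) 𝕜 × Ω =>
      f (q.1.1 * X q.2 * q.1.1ᴴ, P q.2) := by
    have hmul : Continuous fun q : Matrix (Fin n) (Fin n) 𝕜 × Matrix (Fin n) (Fin n) 𝕜 =>
        q.1 * q.2 * q.1ᴴ := (continuous_fst.mul continuous_snd).mul continuous_fst.star
    have hpair : Measurable fun q : unitaryGroup (Fin n) 𝕜 × Ω => (q.1.1, X q.2) :=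
      (measurable_subtype_coe.comp measurable_fst).prodMk (hX.comp measurable_snd)
    exact hf.comp ((hmul.measurable.comp hpair).prodMk (hP.comp measurable_snd))
  calc ∫⁻ ω, f (X ω, P ω) ∂Pr
      = ∫⁻ V : unitaryGroup (Fin n) 𝕜, ∫⁻ ω, f (V.1 * X ω * V.1ᴴ, P ω) ∂Pr ∂ν := by
        simp only [lintegral_conj_left_eq hX hP hindep hinv hf hconj, lintegral_const,
          measure_univ, mul_one]
    _ = ∫⁻ ω, ∫⁻ V : unitaryGroup (Fin n) 𝕜, f (V.1 * X ω * V.1ᴴ, P ω) ∂ν ∂Pr :=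
        lintegral_lintegral_swap hmeas.aemeasurable
    _ ≤ ∫⁻ _, C ∂Pr := lintegral_mono_ae hC
    _ = C := by simp

end ConjInvariance

section AlmostSure

variable {Ω : Type*} [MeasurableSpace Ω] {Pr : Measure Ω}

theorem ae_tendsto_zero_of_lintegral_le {f : ℕ → Ω → ℝ≥0∞} (hf : ∀ n, Measurable (f n))
    {c : ℕ → ℝ} (hc : Summable c) (hfc : ∀ᶠ n in atTop, ∫⁻ ω, f n ω ∂Pr ≤ ENNReal.ofReal (c n)) :
    ∀ᵐ ω ∂Pr, Tendsto (fun n => f n ω) atTop (𝓝 0) := by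
  obtain ⟨N, hN⟩ := eventually_atTop.mp hfc
  have hsum : ∫⁻ ω, ∑' n, f (n + N) ω ∂Pr ≠ ∞ := by
    rw [lintegral_tsum fun n => (hf _).aemeasurable]
    exact ne_top_of_le_ne_top ((summable_nat_add_iff N).mpr hc).tsum_ofReal_ne_top
      (ENNReal.tsum_le_tsum fun n => hN _ (Nat.le_add_left N n))
  filter_upwards [ae_lt_top (Measurable.tsum fun n => hf (n + N)) hsum] with ω hω
  exact (tendsto_add_atTop_iff_nat N).mp (ENNReal.tendsto_atTop_zero_of_tsum_ne_top hω.ne)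

theorem measurable_compressionRatio {n : ℕ} :
    Measurable fun q : Matrix (Fin n) (Fin n) 𝕜 × Matrix (Fin n) (Fin n) 𝕜 =>
      compressionRatio q.1 q.2 := by
  have hsq : Continuous fun A : Matrix (Fin n) (Fin n) 𝕜 => ∑ i, ∑ j, ‖A i j‖ ^ 2 :=
    continuous_finsetSum _ fun i _ => continuous_finsetSum _ fun j _ =>
      ((continuous_id.matrix_elem i j).norm.pow 2)
  simp only [compressionRatio, frobenius_norm_sq]
  exact (hsq.comp ((continuous_snd.mul continuous_fst).mul continuous_snd)).measurable.div
    (hsq.comp continuous_fst).measurable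

open scoped Matrix.Norms.Frobenius in
theorem continuous_compressionRatio_conj {n : ℕ} (H P : Matrix (Fin n) (Fin n) 𝕜) :
    Continuous fun V : unitaryGroup (Fin n) 𝕜 => compressionRatio (V.1 * H * V.1ᴴ) P := by
  have hnorm (V : unitaryGroup (Fin n) 𝕜) : ‖V.1 * H * V.1ᴴ‖ = ‖H‖ := frobenius_norm_conj V.2.1 H
  simp only [compressionRatio, hnorm]
  exact ((((continuous_const.mul (continuous_unitary_conj H)).mul continuous_const).norm).pow
    2).div_const _

theorem measurable_compressionRatio_centeredResolvent {n : ℕ} (z : ℝ)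
    {X P : Ω → Matrix (Fin n) (Fin n) 𝕜} (hX : Measurable X) (hP : Measurable P) :
    Measurable fun ω => compressionRatio (centeredResolvent z (X ω)) (P ω) :=
  (measurable_compressionRatio.comp (((measurable_centeredResolvent z).comp hX).prodMk hP) :)

variable [IsProbabilityMeasure Pr] {ι : Type*} [Fintype ι] [DecidableEq ι] {θ : ι → ℝ}

theorem lintegral_compressionRatio_sq_le {n : ℕ} {X P : Ω → Matrix (Fin n) (Fin n) 𝕜}
    (hXm : Measurable X) (hPm : Measurable P) (hX : ∀ ω, (X ω).IsHermitian)
    (hspikes : ∀ᵐ ω ∂Pr, ∃ U, HasSpikes (P ω) θ U) (hindep : IndepFun X P Pr)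
    (hinv : IsConjInvariant X Pr ∨ IsConjInvariant P Pr) (z : ℝ) :
    ∫⁻ ω, ENNReal.ofReal (compressionRatio (centeredResolvent z (X ω)) (P ω) ^ 2) ∂Pr ≤
      ENNReal.ofReal (ratioConst θ / (n : ℝ) ^ 4) := by
  obtain ⟨ν, hν, hνinv⟩ := exists_haar_unitaryGroup (𝕜 := 𝕜) (n := n)
  refine lintegral_le_of_lintegral_conj_le hXm hPm hindep hinv (f := fun q =>
    ENNReal.ofReal (compressionRatio (centeredResolvent z q.1) q.2 ^ 2)) ?_ ?_ ν ?_
  · exact ((measurable_compressionRatio.comp (((measurable_centeredResolvent z).comp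
      measurable_fst).prodMk measurable_snd)).pow_const 2).ennreal_ofReal
  · intro V A B
    simp only [centeredResolvent_conj, compressionRatio_conj]
  · filter_upwards [hspikes] with ω ⟨U, hU⟩
    simp only [centeredResolvent_conj]
    have hint : Integrable (fun V : unitaryGroup (Fin n) 𝕜 =>
        compressionRatio (V.1 * centeredResolvent z (X ω) * V.1ᴴ) (P ω) ^ 2) ν :=
      integrable_of_continuous ((continuous_compressionRatio_conj _ _).pow 2)
    rw [← ofReal_integral_eq_lintegral_ofReal hint (.of_forall fun _ => sq_nonneg _)]
    exact ENNReal.ofReal_le_ofReal (hU.integral_compressionRatio_sq_le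
      (centeredResolvent_isHermitian (hX ω) z) (trace_centeredResolvent z (X ω)))

theorem ae_tendsto_compressionRatio {X P : (n : ℕ) → Ω → Matrix (Fin n) (Fin n) 𝕜}
    (hXm : ∀ n, Measurable (X n)) (hPm : ∀ n, Measurable (P n))
    (hX : ∀ n ω, (X n ω).IsHermitian)
    (hspikes : ∀ᶠ n in atTop, ∀ᵐ ω ∂Pr, ∃ U, HasSpikes (P n ω) θ U)
    (hindep : ∀ᶠ n in atTop, IndepFun (X n) (P n) Pr)
    (hinv : ∀ᶠ n in atTop, IsConjInvariant (X n) Pr ∨ IsConjInvariant (P n) Pr) (z : ℝ) :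
    ∀ᵐ ω ∂Pr, Tendsto (fun n : ℕ => n * compressionRatio (centeredResolvent z (X n ω)) (P n ω))
      atTop (𝓝 0) := by
  let ratio (n : ℕ) (ω : Ω) : ℝ := compressionRatio (centeredResolvent z (X n ω)) (P n ω)
  have hratio (n : ℕ) : Measurable (ratio n) :=
    measurable_compressionRatio_centeredResolvent z (hXm n) (hPm n)
  have hsq : ∀ᵐ ω ∂Pr,
      Tendsto (fun n : ℕ => ENNReal.ofReal ((n * ratio n ω) ^ 2)) atTop (𝓝 0) := by
    refine ae_tendsto_zero_of_lintegral_le (c := fun n => ratioConst θ * ((n : ℝ) ^ 2)⁻¹)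
      (fun n => (((hratio n).const_mul _).pow_const 2).ennreal_ofReal)
      ((Real.summable_nat_pow_inv.mpr one_lt_two).mul_left (ratioConst θ)) ?_
    filter_upwards [hspikes, hindep, hinv, eventually_gt_atTop 0] with n hs hi hv hn
    calc ∫⁻ ω, ENNReal.ofReal ((n * ratio n ω) ^ 2) ∂Pr
        = ENNReal.ofReal ((n : ℝ) ^ 2) * ∫⁻ ω, ENNReal.ofReal (ratio n ω ^ 2) ∂Pr := by
          rw [← lintegral_const_mul' _ _ ENNReal.ofReal_ne_top]
          simp only [mul_pow, ENNReal.ofReal_mul (sq_nonneg (n : ℝ))]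
      _ ≤ ENNReal.ofReal ((n : ℝ) ^ 2) * ENNReal.ofReal (ratioConst θ / (n : ℝ) ^ 4) := by
          gcongr
          exact lintegral_compressionRatio_sq_le (hXm n) (hPm n) (hX n) hs hi hv z
      _ = ENNReal.ofReal (ratioConst θ * ((n : ℝ) ^ 2)⁻¹) := by
          rw [← ENNReal.ofReal_mul (by positivity)]
          congr 1
          field_simp
  filter_upwards [hsq] with ω hω
  have hnonneg (n : ℕ) : 0 ≤ n * ratio n ω :=
    mul_nonneg n.cast_nonneg (div_nonneg (sq_nonneg _) (sq_nonneg _))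
  have hreal := ((ENNReal.tendsto_toReal ENNReal.zero_ne_top).comp hω).sqrt
  simpa only [Function.comp_def, ENNReal.toReal_ofReal (sq_nonneg _), ENNReal.toReal_zero,
    Real.sqrt_zero, Real.sqrt_sq (hnonneg _)] using hreal

end AlmostSure

section CauchyTransform

variable {μ : Measure ℝ} {a b : ℝ}

theorem measurable_cauchy_kernel (z : ℝ) : Measurable fun t : ℝ => 1 / (z - t) :=
  measurable_const.div (measurable_const.sub measurable_id)

theorem ae_map_neg_le (hμa : ∀ᵐ t ∂μ, a ≤ t) : ∀ᵐ t ∂(μ.map Neg.neg), t ≤ -a := by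
  rw [ae_map_iff measurable_neg.aemeasurable measurableSet_Iic]
  filter_upwards [hμa] with t ht
  exact neg_le_neg ht

theorem cauchyTransform_map_neg (z : ℝ) :
    cauchyTransform (μ.map Neg.neg) z = -cauchyTransform μ (-z) := by
  rw [cauchyTransform, cauchyTransform, integral_map measurable_neg.aemeasurable
    (measurable_cauchy_kernel z).aestronglyMeasurable, ← integral_neg]
  congr 1 with t
  rw [← div_neg]
  congr 1
  ring

theorem integrable_cauchy_kernel [IsFiniteMeasure μ] (hμb : ∀ᵐ t ∂μ, t ≤ b) {z : ℝ} (hz : b < z) :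
    Integrable (fun t => 1 / (z - t)) μ := by
  refine Integrable.of_bound (C := 1 / (z - b))
    (measurable_cauchy_kernel z).aestronglyMeasurable ?_
  filter_upwards [hμb] with t ht
  rw [Real.norm_eq_abs, abs_of_nonneg (one_div_nonneg.mpr (by linarith))]
  exact one_div_le_one_div_of_le (by linarith) (by linarith)

theorem continuousOn_cauchyTransform [IsFiniteMeasure μ] (hμb : ∀ᵐ t ∂μ, t ≤ b) :
    ContinuousOn (cauchyTransform μ) (Set.Ioi b) := by
  intro z (hz : b < z)
  refine (continuousAt_of_dominated (bound := fun _ => 1 / ((z - b) / 2))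
    (.of_forall fun w => (measurable_cauchy_kernel w).aestronglyMeasurable) ?_
    (integrable_const _) ?_).continuousWithinAt
  · filter_upwards [lt_mem_nhds (show (z + b) / 2 < z by linarith)] with w hw
    filter_upwards [hμb] with t ht
    rw [Real.norm_eq_abs, abs_of_nonneg (one_div_nonneg.mpr (by linarith))]
    exact one_div_le_one_div_of_le (by linarith) (by linarith)
  · filter_upwards [hμb] with t ht
    exact continuousAt_const.div (continuousAt_id.sub continuousAt_const) (by grind)

variable [IsProbabilityMeasure μ]

theorem integral_pos_of_ae_pos {f : ℝ → ℝ} (hf : Integrable f μ) (h : ∀ᵐ t ∂μ, 0 < f t) :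
    0 < ∫ t, f t ∂μ := by
  rw [integral_pos_iff_support_of_nonneg_ae (h.mono fun t ht => ht.le) hf]
  refine pos_iff_ne_zero.mpr fun h0 => ?_
  obtain ⟨t, hzero, hpos⟩ := ((measure_eq_zero_iff_ae_notMem.mp h0).and h).exists
  exact hzero hpos.ne'

theorem cauchyTransform_pos (hμb : ∀ᵐ t ∂μ, t ≤ b) {z : ℝ} (hz : b < z) :
    0 < cauchyTransform μ z := by
  refine integral_pos_of_ae_pos (integrable_cauchy_kernel hμb hz) ?_
  filter_upwards [hμb] with t ht
  exact one_div_pos.mpr (by linarith)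

theorem cauchyTransform_le (hμb : ∀ᵐ t ∂μ, t ≤ b) {z : ℝ} (hz : b < z) :
    cauchyTransform μ z ≤ 1 / (z - b) := by
  have h : cauchyTransform μ z ≤ ∫ _t, 1 / (z - b) ∂μ := by
    refine integral_mono_ae (integrable_cauchy_kernel hμb hz) (integrable_const _) ?_
    filter_upwards [hμb] with t ht
    exact one_div_le_one_div_of_le (by linarith) (by linarith)
  simpa using h

theorem strictAntiOn_cauchyTransform (hμb : ∀ᵐ t ∂μ, t ≤ b) :
    StrictAntiOn (cauchyTransform μ) (Set.Ioi b) := by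
  intro z (hz : b < z) w hw hzw
  have hintz := integrable_cauchy_kernel hμb hz
  have hintw := integrable_cauchy_kernel hμb hw
  have hpos : 0 < ∫ t, (1 / (z - t) - 1 / (w - t)) ∂μ := by
    refine integral_pos_of_ae_pos (hintz.sub hintw) ?_
    filter_upwards [hμb] with t ht
    exact sub_pos.mpr (one_div_lt_one_div_of_lt (by linarith) (by linarith))
  rw [integral_sub hintz hintw] at hpos
  exact sub_pos.mp hpos

theorem exists_cauchyTransform_eq (hμb : ∀ᵐ t ∂μ, t ≤ b) {y z : ℝ} (hy : 0 < y) (hz : b < z)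
    (hyz : y ≤ cauchyTransform μ z) : ∃ ρ, b < ρ ∧ cauchyTransform μ ρ = y := by
  let w := max z (b + 1 / y)
  have hbw : b < w := lt_max_of_lt_left hz
  have hw : cauchyTransform μ w ≤ y := by
    have hinv : 1 / y ≤ w - b := by linarith [le_max_right z (b + 1 / y)]
    exact (cauchyTransform_le hμb hbw).trans ((one_div_le hy (sub_pos.mpr hbw)).mp hinv)
  obtain ⟨ρ, hρ, hρy⟩ := intermediate_value_Icc' (le_max_left _ _)
    ((continuousOn_cauchyTransform hμb).mono fun t ht => hz.trans_le ht.1) ⟨hw, hyz⟩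
  exact ⟨ρ, hz.trans_le hρ.1, hρy⟩

theorem tendsto_cauchyRight (hμb : ∀ᵐ t ∂μ, t ≤ b) :
    Tendsto (fun z => (cauchyTransform μ z : EReal)) (𝓝[>] b) (𝓝 (cauchyRight μ b)) ∧
      cauchyRight μ b = sSup ((fun z => (cauchyTransform μ z : EReal)) '' Set.Ioi b) := by
  have hanti : AntitoneOn (fun z => (cauchyTransform μ z : EReal)) (Set.Ioi b) :=
    fun z hz w hw hzw =>
      EReal.coe_le_coe_iff.mpr ((strictAntiOn_cauchyTransform hμb).antitoneOn hz hw hzw)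
  have hlim := hanti.tendsto_nhdsGT (OrderTop.bddAbove _)
  have heq : cauchyRight μ b = _ := rightLim_eq_of_tendsto hlim
  exact ⟨heq ▸ hlim, heq⟩

theorem lt_cauchyRight_iff (hμb : ∀ᵐ t ∂μ, t ≤ b) {y : ℝ} :
    (y : EReal) < cauchyRight μ b ↔ ∃ z, b < z ∧ y < cauchyTransform μ z := by
  rw [(tendsto_cauchyRight hμb).2, lt_sSup_iff]
  simp only [Set.exists_mem_image, Set.mem_Ioi, EReal.coe_lt_coe_iff]

theorem one_div_lt_iff_of_pos {g : EReal} (hg : 0 < g) {θ : ℝ} (hθ : 0 < θ) :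
    1 / g < (θ : EReal) ↔ ((1 / θ : ℝ) : EReal) < g := by
  induction g with
  | bot => exact absurd hg not_lt_bot
  | top => simpa only [EReal.div_top, EReal.coe_lt_top, iff_true] using EReal.coe_pos.mpr hθ
  | coe y =>
    have hy : 0 < y := EReal.coe_pos.mp hg
    rw [← EReal.coe_one, ← EReal.coe_div, EReal.coe_lt_coe_iff, EReal.coe_lt_coe_iff,
      one_div_lt hy hθ]

theorem one_div_cauchyRight_lt_iff (hμb : ∀ᵐ t ∂μ, t ≤ b) {θ : ℝ} (hθ : 0 < θ) :
    1 / cauchyRight μ b < θ ↔ ∃ z, b < z ∧ 1 / θ < cauchyTransform μ z := by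
  have hpos : 0 < cauchyRight μ b :=
    (lt_cauchyRight_iff hμb (y := 0)).mpr
      ⟨b + 1, lt_add_one b, cauchyTransform_pos hμb (lt_add_one b)⟩
  rw [one_div_lt_iff_of_pos hpos hθ, lt_cauchyRight_iff hμb]

theorem cauchyLeft_eq (hμa : ∀ᵐ t ∂μ, a ≤ t) :
    cauchyLeft μ a = -cauchyRight (μ.map Neg.neg) (-a) := by
  have := Measure.isProbabilityMeasure_map (μ := μ) measurable_neg.aemeasurable
  have hlim :=
    ((tendsto_cauchyRight (ae_map_neg_le hμa)).1.comp (tendsto_neg_nhdsLT (a := a))).neg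
  refine leftLim_eq_of_tendsto (hlim.congr fun z => ?_)
  rw [Function.comp_apply, cauchyTransform_map_neg, neg_neg, EReal.coe_neg, neg_neg]

theorem lt_one_div_cauchyLeft_iff (hμa : ∀ᵐ t ∂μ, a ≤ t) {θ : ℝ} :
    (θ : EReal) < 1 / cauchyLeft μ a ↔
      1 / cauchyRight (μ.map Neg.neg) (-a) < ((-θ : ℝ) : EReal) := by
  rw [cauchyLeft_eq hμa, ← EReal.neg_lt_neg_iff, one_div, one_div, EReal.inv_neg, neg_neg,
    EReal.coe_neg]

theorem injOn_cauchyTransform (hμ : ∀ᵐ t ∂μ, t ∈ Set.Icc a b) :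
    Set.InjOn (cauchyTransform μ) (Set.Icc a b)ᶜ := by
  have := Measure.isProbabilityMeasure_map (μ := μ) measurable_neg.aemeasurable
  have hμb := hμ.mono fun t ht => ht.2
  have hμa := ae_map_neg_le (hμ.mono fun t ht => ht.1)
  have hneg {z : ℝ} (hz : z < a) : cauchyTransform μ z < 0 := by
    have h := cauchyTransform_pos hμa (neg_lt_neg hz)
    rwa [cauchyTransform_map_neg, neg_neg, neg_pos] at h
  have hmem {z : ℝ} (hz : z ∈ (Set.Icc a b)ᶜ) : z < a ∨ b < z := by
    rwa [Set.mem_compl_iff, Set.mem_Icc, not_and_or, not_le, not_le] at hz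
  intro z hz w hw h
  rcases hmem hz with hz | hz <;> rcases hmem hw with hw | hw
  · refine neg_injective ((strictAntiOn_cauchyTransform hμa).injOn (neg_lt_neg hz)
      (neg_lt_neg hw) ?_)
    rw [cauchyTransform_map_neg, cauchyTransform_map_neg, neg_neg, neg_neg, h]
  · exact absurd h ((hneg hz).trans (cauchyTransform_pos hμb hw)).ne
  · exact absurd h ((hneg hw).trans (cauchyTransform_pos hμb hz)).ne'
  · exact (strictAntiOn_cauchyTransform hμb).injOn hz hw h

omit [IsProbabilityMeasure μ] in
theorem convexHull_support_eq (hμ : ∀ᵐ t ∂μ, t ∈ Set.Icc a b) (ha : a ∈ μ.support)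
    (hb : b ∈ μ.support) : convexHull ℝ μ.support = Set.Icc a b := by
  have hsub : μ.support ⊆ Set.Icc a b := Measure.support_subset_of_isClosed isClosed_Icc hμ
  refine Set.Subset.antisymm (convexHull_min hsub (convex_Icc a b)) ?_
  rw [← segment_eq_Icc (hsub ha).2]
  exact segment_subset_convexHull ha hb

theorem cauchyInverse_cauchyTransform (hμ : ∀ᵐ t ∂μ, t ∈ Set.Icc a b) (ha : a ∈ μ.support)
    (hb : b ∈ μ.support) {ρ : ℝ} (hρ : ρ ∉ Set.Icc a b) :
    cauchyInverse μ (cauchyTransform μ ρ) = ρ := by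
  rw [cauchyInverse, convexHull_support_eq hμ ha hb]
  exact (injOn_cauchyTransform hμ).leftInvOn_invFunOn hρ

/-- `ℓ` is the point of `[b, ∞)` where the decreasing function `G_μ` crosses the level `y`, with
`ℓ = b` if `G_μ` stays below `y` on `(b, ∞)`. -/
structure IsCrossing (μ : Measure ℝ) (b y ℓ : ℝ) : Prop where
  le : b ≤ ℓ
  lt_cauchyTransform : ∀ z ∈ Set.Ioo b ℓ, y < cauchyTransform μ z
  cauchyTransform_lt : ∀ z, ℓ < z → cauchyTransform μ z < y

theorem isCrossing_of_cauchyTransform_eq (hμb : ∀ᵐ t ∂μ, t ≤ b) {y ρ : ℝ} (hρ : b < ρ)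
    (hy : cauchyTransform μ ρ = y) : IsCrossing μ b y ρ where
  le := hρ.le
  lt_cauchyTransform _ hz := hy ▸ strictAntiOn_cauchyTransform hμb hz.1 hρ hz.2
  cauchyTransform_lt _ hz := hy ▸ strictAntiOn_cauchyTransform hμb hρ (hρ.trans hz) hz

theorem isCrossing_self (hμb : ∀ᵐ t ∂μ, t ≤ b) {y : ℝ}
    (h : ¬∃ z, b < z ∧ y < cauchyTransform μ z) : IsCrossing μ b y b where
  le := le_rfl
  lt_cauchyTransform _ hz := absurd (hz.1.trans hz.2) (lt_irrefl b)
  cauchyTransform_lt z hz := by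
    obtain ⟨w, hbw, hwz⟩ := exists_between hz
    push Not at h
    exact (strictAntiOn_cauchyTransform hμb hbw hz hwz).trans_le (h w hbw)

theorem isCrossing_upper (hμ : ∀ᵐ t ∂μ, t ∈ Set.Icc a b) (ha : a ∈ μ.support)
    (hb : b ∈ μ.support) {θ : ℝ} (hθ : 0 < θ) [Decidable ((θ : EReal) > 1 / cauchyRight μ b)] :
    IsCrossing μ b (1 / θ)
      (if (θ : EReal) > 1 / cauchyRight μ b then cauchyInverse μ (1 / θ) else b) := by
  have hμb := hμ.mono fun t ht => ht.2
  have hiff := one_div_cauchyRight_lt_iff hμb hθ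
  split_ifs with h
  · obtain ⟨z, hz, hlt⟩ := hiff.mp h
    obtain ⟨ρ, hρ, hρθ⟩ := exists_cauchyTransform_eq hμb (one_div_pos.mpr hθ) hz hlt.le
    rw [← hρθ, cauchyInverse_cauchyTransform hμ ha hb fun h => h.2.not_gt hρ]
    exact isCrossing_of_cauchyTransform_eq hμb hρ rfl
  · exact isCrossing_self hμb (mt hiff.mpr h)

theorem isCrossing_lower (hμ : ∀ᵐ t ∂μ, t ∈ Set.Icc a b) (ha : a ∈ μ.support)
    (hb : b ∈ μ.support) {θ : ℝ} (hθ : θ < 0) [Decidable ((θ : EReal) < 1 / cauchyLeft μ a)] :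
    IsCrossing (μ.map Neg.neg) (-a) (1 / -θ)
      (-if (θ : EReal) < 1 / cauchyLeft μ a then cauchyInverse μ (1 / θ) else a) := by
  have := Measure.isProbabilityMeasure_map (μ := μ) measurable_neg.aemeasurable
  have hμa := hμ.mono fun t ht => ht.1
  have hμa' := ae_map_neg_le hμa
  have hθ' := neg_pos.mpr hθ
  have hiff := (lt_one_div_cauchyLeft_iff hμa).trans (one_div_cauchyRight_lt_iff hμa' hθ')
  split_ifs with h
  · obtain ⟨z, hz, hlt⟩ := hiff.mp h
    obtain ⟨ρ, hρ, hρθ⟩ := exists_cauchyTransform_eq hμa' (one_div_pos.mpr hθ') hz hlt.le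
    have hGρ : cauchyTransform μ (-ρ) = 1 / θ := by
      rwa [cauchyTransform_map_neg, div_neg, neg_inj] at hρθ
    rw [← hGρ, cauchyInverse_cauchyTransform hμ ha hb fun h => h.1.not_gt (neg_lt.mp hρ), neg_neg]
    exact isCrossing_of_cauchyTransform_eq hμa' hρ hρθ
  · exact isCrossing_self hμa' (mt hiff.mpr h)

end CauchyTransform

section Spikes

variable {n : ℕ}

theorem hasSpikes_submatrix {ι : Type*} [Fintype ι] [DecidableEq ι] {f : ι → Fin n}
    (hf : Function.Injective f) (W : unitaryGroup (Fin n) 𝕜) {d : Fin n → ℝ}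
    (hd : ∀ i ∉ Set.range f, d i = 0) :
    HasSpikes (W.1 * diagonal (fun i => (d i : 𝕜)) * W.1ᴴ) (d ∘ f) (W.1.submatrix id f) where
  conjTranspose_mul_self := by
    have hW : W.1ᴴ * W.1 = 1 := W.2.1
    calc (W.1.submatrix id f)ᴴ * W.1.submatrix id f = (W.1ᴴ * W.1).submatrix f f := rfl
      _ = 1 := by rw [hW, submatrix_one f hf]
  eq_conj_diagonal := by
    ext a c
    rw [mul_apply, mul_apply]
    simp only [mul_diagonal, conjTranspose_apply, submatrix_apply, id_eq, Function.comp_apply]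
    refine (Fintype.sum_of_injective f hf _ (fun i => W.1 a i * (d i : 𝕜) * star (W.1 c i))
      (fun i hi => ?_) fun j => rfl).symm
    rw [hd i hi, RCLike.ofReal_zero, mul_zero, zero_mul]

theorem card_subtype_coe_filter {α : Type*} (s : Finset α) (p : α → Prop) [DecidablePred p] :
    Fintype.card {a : s // p a} = (s.filter p).card := by
  rw [Fintype.card_subtype, Finset.card_filter, Finset.card_filter,
    Finset.sum_coe_sort s fun a => if p a then 1 else 0]

theorem exists_equiv_of_map_eq {α β γ : Type*} {s : Finset α} {t : Finset β}
    {f : α → γ} {g : β → γ} (h : s.val.map f = t.val.map g) :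
    ∃ e : s ≃ t, ∀ a, g (e a) = f a := by
  classical
  have hcard (c : γ) : Fintype.card {a : s // f a = c} = Fintype.card {b : t // g b = c} := by
    have hcount := congrArg (Multiset.count c) h
    simp only [Multiset.count_map, eq_comm (a := c)] at hcount
    exact (card_subtype_coe_filter s (f · = c)).trans
      (hcount.trans (card_subtype_coe_filter t (g · = c)).symm)
  let e (c : γ) := Fintype.equivOfCardEq (hcard c)
  exact ⟨Equiv.ofFiberEquiv e, fun a => Equiv.ofFiberEquiv_map e a⟩

theorem exists_hasSpikes_of_map_lam {P : Matrix (Fin n) (Fin n) 𝕜} (hP : P.IsHermitian)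
    {r : ℕ} {θ : ℕ → ℝ} (h : ((Finset.Icc 1 n).val.map (lam hP)).filter (fun x => x ≠ 0) =
      (Finset.Icc 1 r).val.map θ) :
    ∃ U, HasSpikes P (fun j : Finset.Icc 1 r => θ j) U := by
  obtain ⟨W, hW⟩ := exists_unitary_diagonalization hP
  rw [Multiset.filter_map] at h
  obtain ⟨e, he⟩ := exists_equiv_of_map_eq
    (s := (Finset.Icc 1 n).filter fun k => lam hP k ≠ 0) (t := Finset.Icc 1 r) h
  have hmem (k : {k // k ∈ (Finset.Icc 1 n).filter fun k => lam hP k ≠ 0}) : 1 ≤ k.1 ∧ k.1 ≤ n :=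
    Finset.mem_Icc.mp (Finset.mem_of_mem_filter _ k.2)
  let f (j : Finset.Icc 1 r) : Fin n := ⟨e.symm j - 1, by have := hmem (e.symm j); omega⟩
  have hf_succ (j) : (f j : ℕ) + 1 = e.symm j := Nat.sub_add_cancel (hmem _).1
  have hf : Function.Injective f := fun i j hij => e.symm.injective <| Subtype.ext <| by
    rw [← hf_succ, ← hf_succ, hij]
  have hrange (i : Fin n) (hi : i ∉ Set.range f) : lam hP (i + 1) = 0 := by
    by_contra h0
    have hi' : (i : ℕ) + 1 ∈ (Finset.Icc 1 n).filter fun k => lam hP k ≠ 0 := by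
      simp only [Finset.mem_filter, Finset.mem_Icc]
      exact ⟨⟨by omega, i.2⟩, h0⟩
    refine hi ⟨e ⟨_, hi'⟩, Fin.ext (Nat.succ_injective ?_)⟩
    rw [Nat.succ_eq_add_one, hf_succ, Equiv.symm_apply_apply]
  have hθ : (fun j : Finset.Icc 1 r => θ j) = (fun i : Fin n => lam hP (i + 1)) ∘ f := by
    funext j
    rw [Function.comp_apply, hf_succ, ← he, Equiv.apply_symm_apply]
  refine ⟨W.1.submatrix id f, ?_⟩
  have hspikes := hasSpikes_submatrix hf W hrange
  rwa [← hW, ← hθ] at hspikes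

end Spikes

section Empirical

theorem integral_empiricalSpectralMeasure {n : ℕ} {A : Matrix (Fin n) (Fin n) 𝕜}
    (hA : A.IsHermitian) (f : BoundedContinuousFunction ℝ ℝ) :
    ∫ t, f t ∂(empiricalSpectralMeasure hA : Measure ℝ) =
      (n : ℝ)⁻¹ * ∑ i : Fin n, f (lam hA (i + 1)) := by
  have hdirac (k : ℕ) :
      ∫ t, f t ∂((diracProba (lam hA k)).toFiniteMeasure : Measure ℝ) = f (lam hA k) :=
    integral_dirac f (lam hA k)
  rw [empiricalSpectralMeasure, FiniteMeasure.toMeasure_smul, FiniteMeasure.toMeasure_sum,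
    integral_smul_nnreal_measure, integral_finsetSum_measure fun k _ => f.integrable _,
    ← sum_lam hA f, NNReal.smul_def]
  simp only [hdirac, NNReal.coe_inv, NNReal.coe_natCast, smul_eq_mul]

theorem tendsto_mean_of_tendsto_empiricalSpectralMeasure
    {X : (n : ℕ) → Matrix (Fin n) (Fin n) 𝕜} {hX : ∀ n, (X n).IsHermitian} {μ : FiniteMeasure ℝ}
    (h : Tendsto (fun n => empiricalSpectralMeasure (hX n)) atTop (𝓝 μ))
    (f : BoundedContinuousFunction ℝ ℝ) :
    Tendsto (fun n : ℕ => (n : ℝ)⁻¹ * ∑ i : Fin n, f (lam (hX n) (i + 1))) atTop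
      (𝓝 (∫ t, f t ∂(μ : Measure ℝ))) := by
  simpa only [integral_empiricalSpectralMeasure] using
    FiniteMeasure.tendsto_iff_forall_integral_tendsto.mp h f

theorem sum_lam_neg {n : ℕ} {A : Matrix (Fin n) (Fin n) 𝕜} (hA : A.IsHermitian) (f : ℝ → ℝ) :
    ∑ i : Fin n, f (lam hA.neg (i + 1)) = ∑ i : Fin n, f (-lam hA (i + 1)) := by
  rw [← Equiv.sum_comp Fin.revPerm fun i : Fin n => f (-lam hA (i + 1))]
  refine Finset.sum_congr rfl fun i _ => ?_
  rw [lam_neg hA (by omega) i.2, Fin.revPerm_apply, Fin.val_rev]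
  congr 3
  omega

theorem sum_lam_le_of_lam_le {n : ℕ} {A : Matrix (Fin n) (Fin n) 𝕜} (hA : A.IsHermitian) {k : ℕ}
    (hk : 1 ≤ k) {c : ℝ} (hc : lam hA k ≤ c) {f : ℝ → ℝ} (hf : ∀ t, f t ≤ 1)
    (hfc : ∀ t ≤ c, f t ≤ 0) : ∑ i : Fin n, f (lam hA (i + 1)) ≤ k := by
  rw [← sum_lam hA f]
  calc ∑ l ∈ Finset.Icc 1 n, f (lam hA l)
      ≤ ∑ l ∈ Finset.Icc 1 n, if l ≤ k then (1 : ℝ) else 0 := by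
        refine Finset.sum_le_sum fun l hl => ?_
        split_ifs with hlk
        · exact hf _
        · exact hfc _ ((lam_antitone hA hk (not_le.mp hlk).le (Finset.mem_Icc.mp hl).2).trans hc)
    _ = ((Finset.Icc 1 n).filter (· ≤ k)).card := Finset.sum_boole _ _
    _ ≤ k := by
        have hsub : (Finset.Icc 1 n).filter (· ≤ k) ⊆ Finset.Icc 1 k := fun l hl => by
          simp only [Finset.mem_filter, Finset.mem_Icc] at hl ⊢
          exact ⟨hl.1.1, hl.2⟩
        simpa using Finset.card_le_card hsub

variable {X : (n : ℕ) → Matrix (Fin n) (Fin n) 𝕜} {μ : Measure ℝ} {b : ℝ}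

theorem eventually_lt_lam [IsFiniteMeasure μ] (hX : ∀ n, (X n).IsHermitian)
    (hconv : ∀ f : BoundedContinuousFunction ℝ ℝ, Tendsto (fun n : ℕ => (n : ℝ)⁻¹ *
      ∑ i : Fin n, f (lam (hX n) (i + 1))) atTop (𝓝 (∫ t, f t ∂μ)))
    {c : ℝ} (hc : 0 < μ (Set.Ioi c)) {k : ℕ} (hk : 1 ≤ k) : ∀ᶠ n in atTop, c < lam (hX n) k := by
  let f : BoundedContinuousFunction ℝ ℝ := BoundedContinuousFunction.ofNormedAddCommGroup
    (fun t => min 1 (max 0 (t - c))) (by fun_prop) 1 fun t => by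
      rw [Real.norm_of_nonneg (le_min zero_le_one (le_max_left _ _))]
      exact min_le_left _ _
  have hpos : 0 < ∫ t, f t ∂μ := by
    have hf0 : ∀ t, 0 ≤ f t := fun t => le_min zero_le_one (le_max_left _ _)
    rw [integral_pos_iff_support_of_nonneg hf0 (f.integrable μ)]
    refine hc.trans_le (measure_mono fun t ht => ?_)
    exact (lt_min zero_lt_one (lt_max_of_lt_right (sub_pos.mpr ht))).ne'
  have hk0 : Tendsto (fun n : ℕ => (n : ℝ)⁻¹ * k) atTop (𝓝 0) := by
    simpa only [zero_mul] using (tendsto_inv_atTop_nhds_zero_nat (𝕜 := ℝ)).mul_const (k : ℝ)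
  filter_upwards [hk0.eventually_lt (hconv f) hpos] with n hn
  by_contra! hlam
  have hsum : ∑ i : Fin n, f (lam (hX n) (i + 1)) ≤ k :=
    sum_lam_le_of_lam_le (hX n) hk hlam (fun t => min_le_left _ _) fun t ht =>
      (min_le_right _ _).trans (max_le le_rfl (sub_nonpos.mpr ht))
  exact hn.not_ge (mul_le_mul_of_nonneg_left hsum (by positivity))

theorem tendsto_lam_of_empirical [IsFiniteMeasure μ] (hX : ∀ n, (X n).IsHermitian)
    (hconv : ∀ f : BoundedContinuousFunction ℝ ℝ, Tendsto (fun n : ℕ => (n : ℝ)⁻¹ *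
      ∑ i : Fin n, f (lam (hX n) (i + 1))) atTop (𝓝 (∫ t, f t ∂μ)))
    (hb : b ∈ μ.support) (hmax : Tendsto (fun n => lam (hX n) 1) atTop (𝓝 b)) {k : ℕ}
    (hk : 1 ≤ k) : Tendsto (fun n => lam (hX n) k) atTop (𝓝 b) := by
  refine tendsto_order.mpr ⟨fun c hc => eventually_lt_lam hX hconv ?_ hk, fun c hc => ?_⟩
  · exact (Measure.mem_support_iff_forall b).mp hb _ (Ioi_mem_nhds hc)
  · filter_upwards [hmax.eventually_lt_const hc, eventually_ge_atTop k] with n hn hkn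
    exact (lam_antitone (hX n) le_rfl hk hkn).trans_lt hn

theorem tendsto_mean_resolvent (hX : ∀ n, (X n).IsHermitian) (hμb : ∀ᵐ t ∂μ, t ≤ b)
    (hconv : ∀ f : BoundedContinuousFunction ℝ ℝ, Tendsto (fun n : ℕ => (n : ℝ)⁻¹ *
      ∑ i : Fin n, f (lam (hX n) (i + 1))) atTop (𝓝 (∫ t, f t ∂μ))) {z δ : ℝ} (hδ : 0 < δ)
    (hbz : b ≤ z - δ) (hz : ∀ᶠ n in atTop, lam (hX n) 1 < z - δ) :
    Tendsto (fun n : ℕ => (n : ℝ)⁻¹ * ∑ i : Fin n, 1 / (z - lam (hX n) (i + 1))) atTop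
      (𝓝 (cauchyTransform μ z)) := by
  have hpos (t : ℝ) : 0 < max (z - t) δ := lt_max_of_lt_right hδ
  -- Truncating `1 / (z - t)` at `z - δ` gives a bounded function with the same averages.
  let f : BoundedContinuousFunction ℝ ℝ := BoundedContinuousFunction.ofNormedAddCommGroup
    (fun t => 1 / max (z - t) δ)
    (continuous_const.div (by fun_prop) fun t => (hpos t).ne') (1 / δ) fun t => by
      rw [Real.norm_of_nonneg (one_div_nonneg.mpr (hpos t).le)]
      exact one_div_le_one_div_of_le hδ (le_max_right _ _)
  have hf (t : ℝ) (ht : t ≤ z - δ) : f t = 1 / (z - t) :=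
    congrArg (1 / ·) (max_eq_left (le_sub_comm.mp ht))
  have hint : ∫ t, f t ∂μ = cauchyTransform μ z := by
    refine integral_congr_ae ?_
    filter_upwards [hμb] with t ht
    exact hf t (ht.trans hbz)
  rw [← hint]
  refine (hconv f).congr' ?_
  filter_upwards [hz] with n hn
  congr 1
  exact Finset.sum_congr rfl fun i _ => hf _ ((lam_le_lam_one (hX n) i).trans hn.le)

end Empirical

section SpikedEnsemble

theorem neg_mem_support_map_neg {μ : Measure ℝ} {a : ℝ} (ha : a ∈ μ.support) :
    -a ∈ (μ.map Neg.neg).support := by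
  rw [Measure.mem_support_iff_forall] at ha ⊢
  intro U hU
  exact (ha _ (continuous_neg.continuousAt hU)).trans_le
    (Measure.le_map_apply measurable_neg.aemeasurable U)

theorem tendsto_lam_sub {X P : (n : ℕ) → Matrix (Fin n) (Fin n) 𝕜} (hX : ∀ n, (X n).IsHermitian)
    (hP : ∀ n, (P n).IsHermitian) {j : ℕ} {ℓ : ℝ}
    (h : Tendsto (fun n => lam ((hX n).neg.add (hP n).neg) (j + 1)) atTop (𝓝 (-ℓ))) :
    Tendsto (fun n => lam ((hX n).add (hP n)) (n - j)) atTop (𝓝 ℓ) := by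
  rw [← neg_neg ℓ]
  refine h.neg.congr' ?_
  filter_upwards [eventually_ge_atTop (j + 1)] with n hn
  rw [lam_congr _ ((hX n).add (hP n)).neg (neg_add _ _).symm, lam_neg _ (by omega) hn, neg_neg,
    Nat.add_sub_add_right]

variable {Ω : Type*} [MeasurableSpace Ω] {ι : Type*} [Fintype ι] [DecidableEq ι]

/-- Random Hermitian matrices `X n` whose empirical eigenvalue distributions converge almost surely
to `μ`, with extreme eigenvalues sticking to the extreme points `a` and `b` of the support of `μ`,
together with finite-rank perturbations `P n` with spikes `θ`, independent of `X n` and in generic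
position with respect to it. Weak convergence is tested on averages over the eigenvalues. -/
structure SpikedEnsemble (Pr : Measure Ω) (X P : (n : ℕ) → Ω → Matrix (Fin n) (Fin n) 𝕜)
    (μ : Measure ℝ) (a b : ℝ) (θ : ι → ℝ) : Prop where
  measurable_left : ∀ n, Measurable (X n)
  measurable_right : ∀ n, Measurable (P n)
  isHermitian_left : ∀ n ω, (X n ω).IsHermitian
  isHermitian_right : ∀ n ω, (P n ω).IsHermitian
  ae_mem_Icc : ∀ᵐ t ∂μ, t ∈ Set.Icc a b
  left_mem_support : a ∈ μ.support
  right_mem_support : b ∈ μ.support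
  ae_tendsto_mean : ∀ᵐ ω ∂Pr, ∀ f : BoundedContinuousFunction ℝ ℝ,
    Tendsto (fun n : ℕ => (n : ℝ)⁻¹ * ∑ i : Fin n, f (lam (isHermitian_left n ω) (i + 1))) atTop
      (𝓝 (∫ t, f t ∂μ))
  ae_tendsto_lam_last : ∀ᵐ ω ∂Pr, Tendsto (fun n => lam (isHermitian_left n ω) n) atTop (𝓝 a)
  ae_tendsto_lam_one : ∀ᵐ ω ∂Pr, Tendsto (fun n => lam (isHermitian_left n ω) 1) atTop (𝓝 b)
  spike_ne_zero : ∀ j, θ j ≠ 0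
  hasSpikes : ∀ᶠ n in atTop, ∀ᵐ ω ∂Pr, ∃ U, HasSpikes (P n ω) θ U
  indepFun : ∀ᶠ n in atTop, IndepFun (X n) (P n) Pr
  isConjInvariant :
    ∀ᶠ n in atTop, IsConjInvariant (X n) Pr ∨ IsConjInvariant (P n) Pr

namespace SpikedEnsemble

variable {Pr : Measure Ω} {X P : (n : ℕ) → Ω → Matrix (Fin n) (Fin n) 𝕜} {μ : Measure ℝ}
  {a b : ℝ} {θ : ι → ℝ}

theorem neg (h : SpikedEnsemble Pr X P μ a b θ) :
    SpikedEnsemble Pr (fun n ω => -X n ω) (fun n ω => -P n ω) (μ.map Neg.neg) (-b) (-a) (-θ) := by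
  have hneg (n : ℕ) : Measurable fun A : Matrix (Fin n) (Fin n) 𝕜 => -A :=
    continuous_neg.measurable
  exact
  { measurable_left := fun n => (hneg n).comp (h.measurable_left n)
    measurable_right := fun n => (hneg n).comp (h.measurable_right n)
    isHermitian_left := fun n ω => (h.isHermitian_left n ω).neg
    isHermitian_right := fun n ω => (h.isHermitian_right n ω).neg
    ae_mem_Icc := by
      refine (ae_map_iff measurable_neg.aemeasurable measurableSet_Icc).mpr ?_
      exact h.ae_mem_Icc.mono fun t ht => ⟨neg_le_neg ht.2, neg_le_neg ht.1⟩
    left_mem_support := neg_mem_support_map_neg h.right_mem_support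
    right_mem_support := neg_mem_support_map_neg h.left_mem_support
    ae_tendsto_mean := by
      filter_upwards [h.ae_tendsto_mean] with ω hω f
      rw [integral_map measurable_neg.aemeasurable f.continuous.aestronglyMeasurable]
      refine (hω (f.compContinuous ⟨Neg.neg, continuous_neg⟩)).congr fun n => ?_
      exact congrArg _ (sum_lam_neg (h.isHermitian_left n ω) f).symm
    ae_tendsto_lam_last := by
      filter_upwards [h.ae_tendsto_lam_one] with ω hω
      refine hω.neg.congr' ?_
      filter_upwards [eventually_ge_atTop 1] with n hn
      rw [lam_neg _ hn le_rfl, Nat.add_sub_cancel_left]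
    ae_tendsto_lam_one := by
      filter_upwards [h.ae_tendsto_lam_last] with ω hω
      refine hω.neg.congr' ?_
      filter_upwards [eventually_ge_atTop 1] with n hn
      rw [lam_neg _ le_rfl hn, Nat.add_sub_cancel]
    spike_ne_zero := fun j => neg_ne_zero.mpr (h.spike_ne_zero j)
    hasSpikes := h.hasSpikes.mono fun n hn => hn.mono fun ω ⟨U, hU⟩ => ⟨U, hU.neg⟩
    indepFun := h.indepFun.mono fun n hn => hn.comp (hneg n) (hneg n)
    isConjInvariant := h.isConjInvariant.mono fun n =>
      Or.imp (IsConjInvariant.neg (h.measurable_left n))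
        (IsConjInvariant.neg (h.measurable_right n)) }

variable [IsProbabilityMeasure Pr]

theorem ae_tendsto_compressedResolvent (h : SpikedEnsemble Pr X P μ a b θ) :
    ∀ᵐ ω ∂Pr, ∃ U : (n : ℕ) → Matrix (Fin n) ι 𝕜, (∀ᶠ n in atTop, HasSpikes (P n ω) θ (U n)) ∧
      ∀ q : ℚ, b < q → Tendsto (fun n => compressedResolvent q (X n ω) (U n)) atTop
        (𝓝 ((cauchyTransform μ q : 𝕜) • 1)) := by
  have hratio : ∀ᵐ ω ∂Pr, ∀ q : ℚ, Tendsto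
      (fun n : ℕ => n * compressionRatio (centeredResolvent q (X n ω)) (P n ω)) atTop (𝓝 0) :=
    ae_all_iff.mpr fun q => ae_tendsto_compressionRatio h.measurable_left h.measurable_right
      h.isHermitian_left h.hasSpikes h.indepFun h.isConjInvariant q
  have hspikes : ∀ᵐ ω ∂Pr, ∀ᶠ n in atTop, ∃ U, HasSpikes (P n ω) θ U := by
    obtain ⟨N, hN⟩ := eventually_atTop.mp h.hasSpikes
    filter_upwards [ae_all_iff.mpr fun n => ae_all_iff.mpr fun hn : N ≤ n => hN n hn] with ω hω
    exact eventually_atTop.mpr ⟨N, hω⟩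
  filter_upwards [h.ae_tendsto_mean, h.ae_tendsto_lam_one, hratio, hspikes]
    with ω hmean hmax hratio hspikes
  choose U hU using skolem.mp hspikes
  refine ⟨U, hU, fun q hq => ?_⟩
  have hδ : 0 < ((q : ℝ) - b) / 2 := half_pos (sub_pos.mpr hq)
  have hz : ∀ᶠ n in atTop, lam (h.isHermitian_left n ω) 1 < (q : ℝ) - ((q : ℝ) - b) / 2 :=
    hmax.eventually_lt_const (by linarith)
  have hG := tendsto_mean_resolvent (fun n => h.isHermitian_left n ω)
    (h.ae_mem_Icc.mono fun t ht => ht.2) hmean hδ (by linarith) hz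
  exact tendsto_compressedResolvent (fun n => h.isHermitian_left n ω) hU h.spike_ne_zero hδ hz hG
    (hratio q)

variable [IsProbabilityMeasure μ]

theorem ae_tendsto_lam_add (h : SpikedEnsemble Pr X P μ a b θ) {k : ℕ} (hk : 1 ≤ k) {ℓ : ℝ}
    (hbℓ : b ≤ ℓ)
    (hlow : ∀ z ∈ Set.Ioo b ℓ, k ≤ Fintype.card {j // 1 < θ j * cauchyTransform μ z})
    (hup : ∀ z, ℓ < z → Fintype.card {j // 1 ≤ θ j * cauchyTransform μ z} < k) :
    ∀ᵐ ω ∂Pr, Tendsto (fun n => lam ((h.isHermitian_left n ω).add (h.isHermitian_right n ω)) k)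
      atTop (𝓝 ℓ) := by
  have hμb := h.ae_mem_Icc.mono fun t ht => ht.2
  filter_upwards [h.ae_tendsto_compressedResolvent, h.ae_tendsto_mean, h.ae_tendsto_lam_one]
    with ω ⟨U, hU, hK⟩ hmean hmax
  exact tendsto_lam_add (fun n => h.isHermitian_left n ω) (fun n => h.isHermitian_right n ω) hU
    (fun k => tendsto_lam_of_empirical _ hmean h.right_mem_support hmax) hK
    (fun z => cauchyTransform_pos hμb) hk hbℓ hlow hup

theorem ae_tendsto_lam_add_of_isCrossing (h : SpikedEnsemble Pr X P μ a b θ) {k : ℕ} (hk : 1 ≤ k)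
    {t ℓ : ℝ} (ht : 0 < t) (hℓ : IsCrossing μ b (1 / t) ℓ)
    (hle : k ≤ Fintype.card {j // t ≤ θ j}) (hlt : Fintype.card {j // t < θ j} < k) :
    ∀ᵐ ω ∂Pr, Tendsto (fun n => lam ((h.isHermitian_left n ω).add (h.isHermitian_right n ω)) k)
      atTop (𝓝 ℓ) := by
  have hG {z : ℝ} (hz : b < z) : 0 < cauchyTransform μ z :=
    cauchyTransform_pos (h.ae_mem_Icc.mono fun t ht => ht.2) hz
  refine h.ae_tendsto_lam_add hk hℓ.le (fun z hz => hle.trans ?_) fun z hz => ?_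
  · refine Fintype.card_subtype_mono _ _ fun j hj => ?_
    calc 1 < t * cauchyTransform μ z := (div_lt_iff₀' ht).mp (hℓ.lt_cauchyTransform z hz)
      _ ≤ θ j * cauchyTransform μ z := mul_le_mul_of_nonneg_right hj (hG hz.1).le
  · refine (Fintype.card_subtype_mono _ _ fun j hj => ?_).trans_lt hlt
    exact lt_of_mul_lt_mul_right (((lt_div_iff₀' ht).mp (hℓ.cauchyTransform_lt z hz)).trans_le hj)
      (hG (hℓ.le.trans_lt hz)).le

theorem ae_tendsto_lam_add_of_card_lt (h : SpikedEnsemble Pr X P μ a b θ) {k : ℕ}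
    (hk : Fintype.card {j // 0 < θ j} < k) :
    ∀ᵐ ω ∂Pr, Tendsto (fun n => lam ((h.isHermitian_left n ω).add (h.isHermitian_right n ω)) k)
      atTop (𝓝 b) := by
  refine h.ae_tendsto_lam_add (by omega) le_rfl (fun z hz => absurd (hz.1.trans hz.2) (lt_irrefl b))
    fun z hz => (Fintype.card_subtype_mono _ _ fun j hj => ?_).trans_lt hk
  exact pos_of_mul_pos_left (zero_lt_one.trans_le hj)
    (cauchyTransform_pos (h.ae_mem_Icc.mono fun t ht => ht.2) hz).le

theorem ae_tendsto_lam_sub_of_isCrossing (h : SpikedEnsemble Pr X P μ a b θ) {j : ℕ} {t ℓ : ℝ}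
    (ht : t < 0) (hℓ : IsCrossing (μ.map Neg.neg) (-a) (1 / -t) (-ℓ))
    (hlt : j < Fintype.card {i // θ i ≤ t}) (hle : Fintype.card {i // θ i < t} ≤ j) :
    ∀ᵐ ω ∂Pr, Tendsto
      (fun n => lam ((h.isHermitian_left n ω).add (h.isHermitian_right n ω)) (n - j))
      atTop (𝓝 ℓ) := by
  have := Measure.isProbabilityMeasure_map (μ := μ) measurable_neg.aemeasurable
  refine (h.neg.ae_tendsto_lam_add_of_isCrossing (k := j + 1) (by omega) (neg_pos.mpr ht) hℓ
    ?_ ?_).mono fun ω => tendsto_lam_sub (h.isHermitian_left · ω) (h.isHermitian_right · ω)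
  · simpa only [Pi.neg_apply, neg_le_neg_iff] using Nat.succ_le_of_lt hlt
  · simpa only [Pi.neg_apply, neg_lt_neg_iff] using Nat.lt_succ_of_le hle

theorem ae_tendsto_lam_sub_of_card_le (h : SpikedEnsemble Pr X P μ a b θ) {j : ℕ}
    (hj : Fintype.card {i // θ i < 0} ≤ j) :
    ∀ᵐ ω ∂Pr, Tendsto
      (fun n => lam ((h.isHermitian_left n ω).add (h.isHermitian_right n ω)) (n - j))
      atTop (𝓝 a) := by
  have := Measure.isProbabilityMeasure_map (μ := μ) measurable_neg.aemeasurable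
  refine (h.neg.ae_tendsto_lam_add_of_card_lt (k := j + 1) ?_).mono fun ω =>
    tendsto_lam_sub (h.isHermitian_left · ω) (h.isHermitian_right · ω)
  simpa only [Pi.neg_apply, neg_pos] using Nat.lt_succ_of_le hj

end SpikedEnsemble

end SpikedEnsemble

section OrderedSpikes

theorem le_card_subtype_of_forall_mem {α : Type*} {s t : Finset α} {p : α → Prop} [DecidablePred p]
    (hts : t ⊆ s) (hp : ∀ a ∈ t, p a) : t.card ≤ Fintype.card {a : s // p a} := by
  rw [card_subtype_coe_filter]
  exact Finset.card_le_card fun a ha => Finset.mem_filter.mpr ⟨hts ha, hp a ha⟩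

theorem card_subtype_le_of_forall_mem {α : Type*} {s t : Finset α} {p : α → Prop} [DecidablePred p]
    (h : ∀ a ∈ s, p a → a ∈ t) : Fintype.card {a : s // p a} ≤ t.card := by
  rw [card_subtype_coe_filter]
  exact Finset.card_le_card fun a ha => (Finset.mem_filter.mp ha).elim (h a)

variable {r i : ℕ} {θ : ℕ → ℝ}

theorem le_card_spike_ge (hθ : AntitoneOn θ (Set.Icc 1 r)) (hi : i ∈ Set.Icc 1 r) :
    i ≤ Fintype.card {j : Finset.Icc 1 r // θ i ≤ θ j} := by
  have hle := le_card_subtype_of_forall_mem (p := (θ i ≤ θ ·))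
    (Finset.Icc_subset_Icc_right hi.2) fun j hj => by
      rw [Finset.mem_Icc] at hj
      exact hθ ⟨hj.1, hj.2.trans hi.2⟩ hi hj.2
  rwa [Nat.card_Icc, Nat.add_sub_cancel] at hle

theorem card_spike_gt_lt (hθ : AntitoneOn θ (Set.Icc 1 r)) (hi : i ∈ Set.Icc 1 r) :
    Fintype.card {j : Finset.Icc 1 r // θ i < θ j} < i := by
  have hle := card_subtype_le_of_forall_mem (t := Finset.Ico 1 i) (p := (θ i < θ ·))
    fun j hj hij => by
      rw [Finset.mem_Icc] at hj
      exact Finset.mem_Ico.mpr ⟨hj.1, not_le.mp fun hji => (hθ hi hj hji).not_gt hij⟩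
  rw [Nat.card_Ico] at hle
  exact hle.trans_lt (Nat.sub_lt hi.1 one_pos)

theorem lt_card_spike_le (hθ : AntitoneOn θ (Set.Icc 1 r)) (hi : i < r) :
    i < Fintype.card {j : Finset.Icc 1 r // θ j ≤ θ (r - i)} := by
  have hle := le_card_subtype_of_forall_mem (s := Finset.Icc 1 r) (t := Finset.Icc (r - i) r)
    (p := (θ · ≤ θ (r - i)))
    (Finset.Icc_subset_Icc_left (by omega)) fun j hj => by
      rw [Finset.mem_Icc] at hj
      exact hθ ⟨by omega, Nat.sub_le r i⟩ ⟨by omega, hj.2⟩ hj.1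
  rw [Nat.card_Icc] at hle
  omega

theorem card_spike_lt_le (hθ : AntitoneOn θ (Set.Icc 1 r)) (hi : i < r) :
    Fintype.card {j : Finset.Icc 1 r // θ j < θ (r - i)} ≤ i := by
  have hle := card_subtype_le_of_forall_mem (t := Finset.Ioc (r - i) r) (p := (θ · < θ (r - i)))
    fun j hj hij => by
      rw [Finset.mem_Icc] at hj
      exact Finset.mem_Ioc.mpr
        ⟨not_le.mp fun hji => (hθ hj ⟨by omega, Nat.sub_le r i⟩ hji).not_gt hij, hj.2⟩
  rw [Nat.card_Ioc] at hle
  omega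

theorem card_spike_pos_le {s : ℕ} (hθ : ∀ i ∈ Set.Icc 1 r, s < i → θ i < 0) :
    Fintype.card {j : Finset.Icc 1 r // 0 < θ j} ≤ s := by
  have hle := card_subtype_le_of_forall_mem (t := Finset.Icc 1 s) (p := (0 < θ ·))
    fun j hj hpos => by
      rw [Finset.mem_Icc] at hj ⊢
      exact ⟨hj.1, not_lt.mp fun hsj => (hθ j hj hsj).not_gt hpos⟩
  rwa [Nat.card_Icc, Nat.add_sub_cancel] at hle

theorem card_spike_neg_le {s : ℕ} (hθ : ∀ i ∈ Set.Icc 1 r, i ≤ s → 0 < θ i) :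
    Fintype.card {j : Finset.Icc 1 r // θ j < 0} ≤ r - s := by
  rw [← Nat.card_Ioc]
  refine card_subtype_le_of_forall_mem (p := (θ · < 0)) fun j hj hneg => ?_
  rw [Finset.mem_Icc] at hj
  exact Finset.mem_Ioc.mpr ⟨not_le.mp fun hjs => (hθ j hj hjs).not_gt hneg, hj.2⟩

end OrderedSpikes

end SpikedModel

theorem theorem2p1 {𝕜 : Type*} [RCLike 𝕜]
    {Ω : Type*} [MeasurableSpace Ω] (Pr : Measure Ω) [IsProbabilityMeasure Pr]
    -- the random matrices `X n` and `P n`, real symmetric (`𝕜 = ℝ`) or Hermitian (`𝕜 = ℂ`)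
    (X P : (n : ℕ) → Ω → Matrix (Fin n) (Fin n) 𝕜)
    (hXm : ∀ n, Measurable (X n)) (hPm : ∀ n, Measurable (P n))
    (hX : ∀ n ω, (X n ω).IsHermitian) (hP : ∀ n ω, (P n ω).IsHermitian)
    -- the limiting spectral measure and the edges of its support
    (μ : ProbabilityMeasure ℝ) (hμ : IsCompact (μ : Measure ℝ).support)
    (a b : ℝ) (ha : a = sInf (μ : Measure ℝ).support) (hb : b = sSup (μ : Measure ℝ).support)
    (hconv : ∀ᵐ ω ∂Pr, Tendsto (fun n => empiricalSpectralMeasure (hX n ω)) atTop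
      (𝓝 μ.toFiniteMeasure))
    (hmin : ∀ᵐ ω ∂Pr, Tendsto (fun n => lam (hX n ω) n) atTop (𝓝 a))
    (hmax : ∀ᵐ ω ∂Pr, Tendsto (fun n => lam (hX n ω) 1) atTop (𝓝 b))
    -- the non-zero eigenvalues `θ 1 ≥ ⋯ ≥ θ s > 0 > θ (s + 1) ≥ ⋯ ≥ θ r` of the perturbation
    (r : ℕ) (hr : 1 ≤ r) (s : ℕ) (hsr : s ≤ r) (θ : ℕ → ℝ)
    (hθ : AntitoneOn θ (Set.Icc 1 r))
    (hθpos : ∀ i ∈ Set.Icc 1 r, i ≤ s → 0 < θ i)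
    (hθneg : ∀ i ∈ Set.Icc 1 r, s < i → θ i < 0)
    (hPeig : ∀ n, r ≤ n → ∀ᵐ ω ∂Pr,
      ((Finset.Icc 1 n).val.map (lam (hP n ω))).filter (fun x => x ≠ 0) =
        (Finset.Icc 1 r).val.map θ)
    -- independence and invariance
    (hindep : ∀ n, r ≤ n → IndepFun (X n) (P n) Pr)
    (hinv : ∀ n, r ≤ n → IsConjInvariant (X n) Pr ∨ IsConjInvariant (P n) Pr) :
    -- the largest eigenvalues
    (∀ i, 1 ≤ i → i ≤ s → ∀ᵐ ω ∂Pr,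
      Tendsto (fun n => lam ((hX n ω).add (hP n ω)) i) atTop
        (𝓝 (if (θ i : EReal) > 1 / cauchyRight μ b then cauchyInverse μ (1 / θ i) else b))) ∧
    (∀ i, s < i → ∀ᵐ ω ∂Pr,
      Tendsto (fun n => lam ((hX n ω).add (hP n ω)) i) atTop (𝓝 b)) ∧
    -- the smallest eigenvalues
    (∀ j, j < r - s → ∀ᵐ ω ∂Pr,
      Tendsto (fun n => lam ((hX n ω).add (hP n ω)) (n - j)) atTop
        (𝓝 (if (θ (r - j) : EReal) < 1 / cauchyLeft μ a
          then cauchyInverse μ (1 / θ (r - j)) else a))) ∧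
    (∀ j, r - s ≤ j → ∀ᵐ ω ∂Pr,
      Tendsto (fun n => lam ((hX n ω).add (hP n ω)) (n - j)) atTop (𝓝 a)) := by
  have hne : (μ : Measure ℝ).support.Nonempty := Measure.nonempty_support (NeZero.ne _)
  have hmem (j : Finset.Icc 1 r) : (j : ℕ) ∈ Set.Icc 1 r := Finset.mem_Icc.mp j.2
  have h : SpikedEnsemble Pr X P μ a b fun j : Finset.Icc 1 r => θ j :=
    ⟨hXm, hPm, hX, hP,
      mem_of_superset Measure.support_mem_ae fun t ht =>
        ⟨ha ▸ csInf_le hμ.bddBelow ht, hb ▸ le_csSup hμ.bddAbove ht⟩,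
      ha ▸ hμ.sInf_mem hne, hb ▸ hμ.sSup_mem hne,
      hconv.mono fun ω => tendsto_mean_of_tendsto_empiricalSpectralMeasure, hmin, hmax,
      fun j => (le_or_gt (j : ℕ) s).elim (fun hj => (hθpos j (hmem j) hj).ne')
        fun hj => (hθneg j (hmem j) hj).ne,
      eventually_atTop.mpr ⟨r, fun n hn => (hPeig n hn).mono fun ω =>
        exists_hasSpikes_of_map_lam (hP n ω)⟩,
      eventually_atTop.mpr ⟨r, hindep⟩, eventually_atTop.mpr ⟨r, hinv⟩⟩
  refine ⟨fun i hi his => ?_, fun i hi => ?_, fun j hj => ?_, fun j hj => ?_⟩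
  · have hir : i ∈ Set.Icc 1 r := ⟨hi, his.trans hsr⟩
    have hpos := hθpos i hir his
    exact h.ae_tendsto_lam_add_of_isCrossing hi hpos
      (isCrossing_upper h.ae_mem_Icc h.left_mem_support h.right_mem_support hpos)
      (le_card_spike_ge hθ hir) (card_spike_gt_lt hθ hir)
  · exact h.ae_tendsto_lam_add_of_card_lt ((card_spike_pos_le hθneg).trans_lt hi)
  · have hjr : j < r := by omega
    have hneg := hθneg (r - j) ⟨by omega, Nat.sub_le r j⟩ (by omega)
    exact h.ae_tendsto_lam_sub_of_isCrossing hneg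
      (isCrossing_lower h.ae_mem_Icc h.left_mem_support h.right_mem_support hneg)
      (lt_card_spike_le hθ hjr) (card_spike_lt_le hθ hjr)
  · exact h.ae_tendsto_lam_sub_of_card_le ((card_spike_neg_le hθpos).trans hj)
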